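/- Let $O\subseteq\mathbb{R}^n$ be open, let $m\ge 1$, and let $D_i\subseteq\partial O$ be closed (possibly empty) for $i=1,\dots,m$; put $D=(D_i)_{i=1}^m$ and $N=(n+1)m$. All function spaces are complex. Let $\mathrm{W}^{1,2}_{D_i}(O)$ be the closure in $\mathrm{W}^{1,2}(O)$ of $\{\theta|_O : \theta\in \mathrm{C}_0^\infty(\mathbb{R}^n),\ \operatorname{dist}(\operatorname{supp}\theta,D_i)>0\}$ (no distance condition if $D_i=\emptyset$), and let $\mathbb{W}^{1,2}_D(O)=\bigoplus_{i=1}^m \mathrm{W}^{1,2}_{D_i}(O)\subseteq \mathrm{L}^2(O)^m$. Let $\nabla_D$ be the weak gradient with domain $\mathbb{W}^{1,2}_D(O)$, and let $T_D=(1,\nabla_D)^t:\mathbb{W}^{1,2}_D(O)\subseteq \mathrm{L}^2(O)^m\to \mathrm{L}^2(O)^N$, $T_Du=(u,\nabla_D u)$, with Hilbert space adjoint $T_D^*$. Define $-\Delta_D+1=T_D^*T_D$ in $\mathrm{L}^2(O)^m$ and $M_D=T_DT_D^*$ in $\mathrm{L}^2(O)^N$, both with their maximal domains. For $\varphi\in(0,\pi)$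 let $\mathrm{S}_\varphi=\{z\in\mathbb{C}\setminus\{0\}: |\arg z|<\varphi\}$ and let $\mathrm{H}^\infty(\mathrm{S}_\varphi)$ be the space of bounded holomorphic functions on $\mathrm{S}_\varphi$. For an injective sectorial operator $A$ of angle zero and $f\in \mathrm{H}^\infty(\mathrm{S}_\varphi)$, put $f(A)=e(A)^{-1}(ef)(A)$ with its maximal domain $\{x : (ef)(A)x\in\operatorname{ran} e(A)\}$, where $e(z)=z(1+z)^{-2}$, and where for $g\in\{e,ef\}$ $$g(A)=\frac{1}{2\pi i}\int_{\partial \mathrm{S}_\nu} g(z)(z-A)^{-1}\,\mathrm{d}z,\qquad \nu\in(0,\varphi),$$ with $\partial \mathrm{S}_\nu$ positively oriented (the choice of $\nu$ is immaterial; the claim below holds with each of them). The operator $-\Delta_D+1$ is injective; since $M_D$ need not be, $f(M_D)$ denotes $f$ of the part of $M_D$ in $\overline{\operatorname{ran}(M_D)}$, an operator in $\overline{\operatorname{ran}(M_D)}$. Let $\varphi\in(0,\pi)$, $f\in \mathrm{H}^\infty(\mathrm{S}_\varphi)$ and $u\in\mathbb{W}^{1,2}_D(O)$. Then $u\in\operatorname{dom}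 f(-\Delta_D+1)$, $f(-\Delta_D+1)u\in\mathbb{W}^{1,2}_D(O)=\operatorname{dom}(T_D)$, $T_Du\in\overline{\operatorname{ran}(M_D)}$, $T_Du\in\operatorname{dom} f(M_D)$, and $$T_D\,f(-\Delta_D+1)\,u=f(M_D)\,T_D\,u .$$ -/

import Mathlib

open MeasureTheory
open scoped ContDiff

/-! ## Sobolev spaces with mixed boundary conditions -/

namespace MixedBC

/-- Euclidean space `ℝⁿ`. -/
abbrev E (n : ℕ) : Type := EuclideanSpace ℝ (Fin n)

variable {n m : ℕ}

/-- The complex Hilbert space `L²(O)`, for Lebesgue measure on the open set `O ⊆ ℝⁿ`. -/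
abbrev L2 (O : TopologicalSpace.Opens (E n)) : Type :=
  Lp ℂ 2 ((volume : Measure (E n)).restrict (O : Set (E n)))

/-- `L²(O)^κ` for a finite index set `κ`, with its Hilbert space (`ℓ²`-sum) norm. -/
abbrev L2Pow (O : TopologicalSpace.Opens (E n)) (κ : Type) : Type :=
  PiLp 2 (fun _ : κ => L2 O)

/-- `g` is the weak partial derivative `∂_j u` on `O`:
`∫_O u ∂_j ψ = - ∫_O g ψ` for all test functions `ψ ∈ C_c^∞(O)`. -/
def HasWeakDeriv (O : TopologicalSpace.Opens (E n)) (j : Fin n) (u g : L2 O) : Prop :=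
  ∀ ψ : E n → ℝ, ContDiff ℝ ∞ ψ → HasCompactSupport ψ → tsupport ψ ⊆ (O : Set (E n)) →
    ∫ x in (O : Set (E n)), (fderiv ℝ ψ x (EuclideanSpace.single j 1)) • u x
      = - ∫ x in (O : Set (E n)), ψ x • g x

theorem integrable_test_smul {O : TopologicalSpace.Opens (E n)} (u : L2 O) {ψ : E n → ℝ}
    (hc : Continuous ψ) (hs : HasCompactSupport ψ) :
    Integrable (fun x => ψ x • u x) ((volume : Measure (E n)).restrict (O : Set (E n))) := by
  have h1 : LocallyIntegrable (fun x => u x)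
      ((volume : Measure (E n)).restrict (O : Set (E n))) :=
    (Lp.memLp u).locallyIntegrable (by norm_num)
  exact h1.integrable_smul_left_of_hasCompactSupport hc hs

theorem integrable_test_deriv_smul {O : TopologicalSpace.Opens (E n)} (u : L2 O) {ψ : E n → ℝ}
    (hc : ContDiff ℝ ∞ ψ) (hs : HasCompactSupport ψ) (v : E n) :
    Integrable (fun x => (fderiv ℝ ψ x v) • u x)
      ((volume : Measure (E n)).restrict (O : Set (E n))) :=
  integrable_test_smul u ((hc.continuous_fderiv (by simp)).clm_apply continuous_const)
    (hs.fderiv_apply ℝ v)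

theorem HasWeakDeriv.add {O : TopologicalSpace.Opens (E n)} {j : Fin n} {u g u' g' : L2 O}
    (h : HasWeakDeriv O j u g) (h' : HasWeakDeriv O j u' g') :
    HasWeakDeriv O j (u + u') (g + g') := by
  intro ψ hψ hs ht
  have e1 : ∫ x in (O : Set (E n)), (fderiv ℝ ψ x (EuclideanSpace.single j 1)) • (u + u') x
      = ∫ x in (O : Set (E n)), ((fderiv ℝ ψ x (EuclideanSpace.single j 1)) • u x
        + (fderiv ℝ ψ x (EuclideanSpace.single j 1)) • u' x) := by
    refine integral_congr_ae ?_
    filter_upwards [Lp.coeFn_add u u'] with x hx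
    rw [hx, Pi.add_apply, smul_add]
  have e2 : ∫ x in (O : Set (E n)), ψ x • (g + g') x
      = ∫ x in (O : Set (E n)), (ψ x • g x + ψ x • g' x) := by
    refine integral_congr_ae ?_
    filter_upwards [Lp.coeFn_add g g'] with x hx
    rw [hx, Pi.add_apply, smul_add]
  rw [e1, e2, integral_add (integrable_test_deriv_smul u hψ hs _)
    (integrable_test_deriv_smul u' hψ hs _),
    integral_add (integrable_test_smul g hψ.continuous hs)
      (integrable_test_smul g' hψ.continuous hs), h ψ hψ hs ht, h' ψ hψ hs ht]
  ring

theorem HasWeakDeriv.smul {O : TopologicalSpace.Opens (E n)} {j : Fin n} {u g : L2 O} (c : ℂ)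
    (h : HasWeakDeriv O j u g) : HasWeakDeriv O j (c • u) (c • g) := by
  intro ψ hψ hs ht
  have e1 : ∫ x in (O : Set (E n)), (fderiv ℝ ψ x (EuclideanSpace.single j 1)) • (c • u) x
      = ∫ x in (O : Set (E n)), c • ((fderiv ℝ ψ x (EuclideanSpace.single j 1)) • u x) := by
    refine integral_congr_ae ?_
    filter_upwards [Lp.coeFn_smul c u] with x hx
    rw [hx, Pi.smul_apply, smul_comm]
  have e2 : ∫ x in (O : Set (E n)), ψ x • (c • g) x
      = ∫ x in (O : Set (E n)), c • (ψ x • g x) := by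
    refine integral_congr_ae ?_
    filter_upwards [Lp.coeFn_smul c g] with x hx
    rw [hx, Pi.smul_apply, smul_comm]
  rw [e1, e2, integral_smul, integral_smul, h ψ hψ hs ht, smul_neg]

theorem HasWeakDeriv.zero (O : TopologicalSpace.Opens (E n)) (j : Fin n) :
    HasWeakDeriv O j 0 0 := by
  intro ψ hψ hs ht
  have e (θ : E n → ℝ) : ∫ x in (O : Set (E n)), θ x • (0 : L2 O) x = 0 := by
    rw [← integral_zero (E n) ℂ
      (μ := (volume : Measure (E n)).restrict (O : Set (E n)))]
    refine integral_congr_ae ?_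
    filter_upwards [Lp.coeFn_zero ℂ 2 ((volume : Measure (E n)).restrict (O : Set (E n)))]
      with x hx
    rw [hx, Pi.zero_apply, smul_zero]
  rw [e, e, neg_zero]

/-- Weak derivatives are unique. -/
theorem HasWeakDeriv.eq_zero {O : TopologicalSpace.Opens (E n)} {j : Fin n} {g : L2 O}
    (h : HasWeakDeriv O j 0 g) : g = 0 := by
  have hloc : LocallyIntegrableOn (fun x => g x) (O : Set (E n)) volume :=
    locallyIntegrableOn_of_locallyIntegrable_restrict
      ((Lp.memLp g).locallyIntegrable (by norm_num))
  have hae := O.isOpen.ae_eq_zero_of_integral_contDiff_smul_eq_zero hloc (fun ψ hψ hs ht => by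
    have h1 := h ψ hψ hs ht
    have h0 : ∫ x in (O : Set (E n)),
        (fderiv ℝ ψ x (EuclideanSpace.single j 1)) • (0 : L2 O) x = 0 := by
      rw [← integral_zero (E n) ℂ
        (μ := (volume : Measure (E n)).restrict (O : Set (E n)))]
      refine integral_congr_ae ?_
      filter_upwards [Lp.coeFn_zero ℂ 2 ((volume : Measure (E n)).restrict (O : Set (E n)))]
        with x hx
      rw [hx, Pi.zero_apply, smul_zero]
    rw [h0, eq_comm, neg_eq_zero] at h1
    rw [← h1, setIntegral_eq_integral_of_forall_compl_eq_zero]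
    intro x hx
    rw [image_eq_zero_of_notMem_tsupport (fun hx' => hx (ht hx')), zero_smul])
  rw [Lp.eq_zero_iff_ae_eq_zero]
  exact (ae_restrict_iff' O.isOpen.measurableSet).2 hae

/-- The Hilbert space `W^{1,2}(O)`: all `u ∈ L²(O)` with weak gradient `∇u ∈ L²(O)ⁿ`, with norm
`(‖u‖² + ‖∇u‖²)^{1/2}`. It is realised as the space of pairs `(u, ∇u)` inside
`L²(O) × L²(O)ⁿ`; by uniqueness of weak derivatives such a pair is determined by `u`. -/
def W12 (O : TopologicalSpace.Opens (E n)) :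
    Submodule ℂ (WithLp 2 (L2 O × L2Pow O (Fin n))) where
  carrier := {p | ∀ j, HasWeakDeriv O j p.fst (p.snd j)}
  add_mem' := fun hp hq j => (hp j).add (hq j)
  zero_mem' := fun j => HasWeakDeriv.zero O j
  smul_mem' := fun c _ hp j => (hp j).smul c

theorem W12.snd_eq {O : TopologicalSpace.Opens (E n)} (p q : W12 O)
    (h : p.1.fst = q.1.fst) : p.1.snd = q.1.snd := by
  have hd := (p - q).2
  ext1 j
  have hj := hd j
  have h0 : ((p - q : W12 O) : WithLp 2 (L2 O × L2Pow O (Fin n))).fst = 0 := by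
    simp [h]
  rw [h0] at hj
  have := hj.eq_zero
  simpa [sub_eq_zero] using this

/-- The test functions `C^∞_D(O)`: restrictions to `O` of (complex-valued) `θ ∈ C_0^∞(ℝⁿ)` with
`dist(supp θ, D) > 0`, as a subspace of `W^{1,2}(O)`. (For `D = ∅` the distance is infinite,
so there is no condition.) -/
def testSpace (O : TopologicalSpace.Opens (E n)) (D : Set (E n)) : Submodule ℂ (W12 O) where
  carrier := {p | ∃ θ : E n → ℂ, ContDiff ℝ ∞ θ ∧ HasCompactSupport θ ∧
    (∃ δ : ℝ, 0 < δ ∧ ∀ x ∈ tsupport θ, ∀ y ∈ D, δ ≤ dist x y) ∧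
    p.1.fst =ᵐ[(volume : Measure (E n)).restrict (O : Set (E n))] θ}
  add_mem' := by
    rintro p q ⟨θ, h1, h2, ⟨δ, hδ, h3⟩, h4⟩ ⟨θ', h1', h2', ⟨δ', hδ', h3'⟩, h4'⟩
    refine ⟨θ + θ', h1.add h1', h2.add h2', ⟨min δ δ', lt_min hδ hδ', fun x hx y hy => ?_⟩, ?_⟩
    · rcases tsupport_add θ θ' hx with hx | hx
      · exact (min_le_left _ _).trans (h3 x hx y hy)
      · exact (min_le_right _ _).trans (h3' x hx y hy)
    · exact (Lp.coeFn_add _ _).trans (h4.add h4')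
  zero_mem' := ⟨0, contDiff_const, HasCompactSupport.zero, ⟨1, one_pos, by simp [tsupport]⟩,
    Lp.coeFn_zero _ _ _⟩
  smul_mem' := by
    rintro c p ⟨θ, h1, h2, ⟨δ, hδ, h3⟩, h4⟩
    refine ⟨c • θ, h1.const_smul c, h2.smul_left (f := fun _ => c),
      ⟨δ, hδ, fun x hx y hy => h3 x (tsupport_smul_subset_right (fun _ => c) θ hx) y hy⟩, ?_⟩
    exact (Lp.coeFn_smul _ _).trans (h4.const_smul c)

/-- `W^{1,2}_D(O)`: the closure of `C^∞_D(O)` in `W^{1,2}(O)`. -/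
noncomputable def W12D (O : TopologicalSpace.Opens (E n)) (D : Set (E n)) : Submodule ℂ (W12 O) :=
  (testSpace O D).topologicalClosure

/-- `𝕎^{1,2}_D(O) = ⨁_i W^{1,2}_{D_i}(O)`, as a subspace of `L²(O)^m`. -/
def W12Sys (O : TopologicalSpace.Opens (E n)) (D : Fin m → Set (E n)) :
    Submodule ℂ (L2Pow O (Fin m)) where
  carrier := {u | ∀ i, ∃ w ∈ W12D O (D i), w.1.fst = u i}
  add_mem' := by
    intro u v hu hv i
    obtain ⟨w, hw, h⟩ := hu i
    obtain ⟨w', hw', h'⟩ := hv i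
    exact ⟨w + w', add_mem hw hw', by simp [h, h']⟩
  zero_mem' := fun i => ⟨0, zero_mem _, by simp⟩
  smul_mem' := by
    intro c u hu i
    obtain ⟨w, hw, h⟩ := hu i
    exact ⟨c • w, Submodule.smul_mem _ c hw, by simp [h]⟩

/-- The gradient `∇_D : 𝕎^{1,2}_D(O) ⊆ L²(O)^m → L²(O)^{nm}`; the `(i, j)` entry of `∇_D u` is the
weak derivative `∂_j u_i`. -/
noncomputable def gradD (O : TopologicalSpace.Opens (E n)) (D : Fin m → Set (E n)) :
    L2Pow O (Fin m) →ₗ.[ℂ] L2Pow O (Fin m × Fin n) where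
  domain := W12Sys O D
  toFun :=
    { toFun := fun u => WithLp.toLp 2 fun k => (u.2 k.1).choose.1.snd k.2
      map_add' := by
        intro u v
        ext1 k
        have h := W12.snd_eq ((u + v).2 k.1).choose ((u.2 k.1).choose + (v.2 k.1).choose) (by
          have h1 := ((u + v).2 k.1).choose_spec.2
          have h2 := (u.2 k.1).choose_spec.2
          have h3 := (v.2 k.1).choose_spec.2
          exact h1.trans (by simp [h2, h3]))
        have := congrArg (fun a : L2Pow O (Fin n) => a k.2) h
        simpa using this
      map_smul' := by
        intro c u
        ext1 k
        have h := W12.snd_eq ((c • u).2 k.1).choose (c • (u.2 k.1).choose) (by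
          have h1 := ((c • u).2 k.1).choose_spec.2
          have h2 := (u.2 k.1).choose_spec.2
          exact h1.trans (by simp [h2]))
        have := congrArg (fun a : L2Pow O (Fin n) => a k.2) h
        simpa using this }

/-- The space `L²(O)^N`, `N = (n + 1) m`, of vector fields `(F₀, F')` with `F₀ ∈ L²(O)^m` and
`F' ∈ L²(O)^{nm}`. -/
abbrev VField (O : TopologicalSpace.Opens (E n)) (m : ℕ) : Type :=
  WithLp 2 (L2Pow O (Fin m) × L2Pow O (Fin m × Fin n))

/-- The inhomogeneous gradient `T_D = (1, ∇_D)ᵗ : 𝕎^{1,2}_D(O) ⊆ L²(O)^m → L²(O)^N`. -/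
noncomputable def opT (O : TopologicalSpace.Opens (E n)) (D : Fin m → Set (E n)) :
    L2Pow O (Fin m) →ₗ.[ℂ] VField O m where
  domain := W12Sys O D
  toFun := (WithLp.linearEquiv 2 ℂ (L2Pow O (Fin m) × L2Pow O (Fin m × Fin n))).symm.toLinearMap ∘ₗ
    (W12Sys O D).subtype.prod (gradD O D).toFun

/-! ## Unbounded operators and the sectorial functional calculus -/

section Operators

variable {X Y Z : Type*} [NormedAddCommGroup X] [NormedSpace ℂ X] [NormedAddCommGroup Y]
  [NormedSpace ℂ Y] [NormedAddCommGroup Z] [NormedSpace ℂ Z]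

/-- The composition `B A` of unbounded operators with its maximal domain
`{x ∈ dom A : A x ∈ dom B}`. -/
noncomputable def compMax (B : Y →ₗ.[ℂ] Z) (A : X →ₗ.[ℂ] Y) : X →ₗ.[ℂ] Z :=
  B.comp (A.domRestrict ((B.domain.comap A.toFun).map A.domain.subtype)) (by
    rintro ⟨x, hx⟩
    obtain ⟨y, hy, hyx⟩ := hx.1
    have h : A.domRestrict ((B.domain.comap A.toFun).map A.domain.subtype) ⟨x, hx⟩ = A y :=
      LinearPMap.domRestrict_apply hyx.symm
    rw [h]
    exact hy)

/-- The part of an operator `A` in a subspace `S`: the restriction of `A` to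
`{x ∈ S ∩ dom A : A x ∈ S}`, as an operator in `S`, given through its graph. -/
noncomputable def partIn (A : X →ₗ.[ℂ] X) (S : Submodule ℂ X) : S →ₗ.[ℂ] S :=
  (A.graph.comap (S.subtype.prodMap S.subtype)).toLinearPMap

/-- The open sector `S_φ` of opening angle `2φ` around the positive real axis. -/
def sector (φ : ℝ) : Set ℂ := {z | z ≠ 0 ∧ |z.arg| < φ}

/-- `f ∈ H^∞(S_φ)`: `f` is holomorphic and bounded on `S_φ`. -/
structure IsHInfty (φ : ℝ) (f : ℂ → ℂ) : Prop where
  holomorphic : DifferentiableOn ℂ f (sector φ)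
  bounded : ∃ C : ℝ, ∀ z ∈ sector φ, ‖f z‖ ≤ C

/-- `R` is the bounded two-sided inverse `(z - A)⁻¹` of `z - A : dom A → X`. -/
def IsResolventAt (A : X →ₗ.[ℂ] X) (z : ℂ) (R : X →L[ℂ] X) : Prop :=
  (∀ x : A.domain, R (z • (x : X) - A x) = x) ∧
    ∀ y : X, ∃ h : R y ∈ A.domain, z • R y - A ⟨R y, h⟩ = y

open Classical in
/-- The resolvent `(z - A)⁻¹`; it has the value `0` if `z` is in the spectrum of `A`. -/
noncomputable def resolventOp (A : X →ₗ.[ℂ] X) (z : ℂ) : X →L[ℂ] X :=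
  if h : ∃ R, IsResolventAt A z R then h.choose else 0

/-- The Cauchy integral `(2πi)⁻¹ ∫_Γ g(z) (z - A)⁻¹ dz` over the positively oriented boundary `Γ`
of the sector `S_ν` (coming in from `∞` along `ℝ₊ e^{iν}` and going out to `∞` along
`ℝ₊ e^{-iν}`). For a sectorial operator `A` of angle `< ν` this is `g(A)` for
`g ∈ H₀^∞(S_φ)`, `φ > ν`, that is, for `g ∈ H^∞(S_φ)` with
`|g(z)| ≤ C min(|z|^s, |z|^{-s})` for some `C, s > 0`. -/
noncomputable def cauchyInt (A : X →ₗ.[ℂ] X) (ν : ℝ) (g : ℂ → ℂ) : X →L[ℂ] X :=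
  (2 * Real.pi * Complex.I)⁻¹ •
    ((∫ r in Set.Ioi (0 : ℝ), (g (r * Complex.exp (-(ν * Complex.I))) *
        Complex.exp (-(ν * Complex.I))) • resolventOp A (r * Complex.exp (-(ν * Complex.I))))
      - ∫ r in Set.Ioi (0 : ℝ), (g (r * Complex.exp (ν * Complex.I)) *
        Complex.exp (ν * Complex.I)) • resolventOp A (r * Complex.exp (ν * Complex.I)))

/-- The regularizer `e(z) = z (1 + z)⁻²`. -/
noncomputable def regularizer (z : ℂ) : ℂ := z / (1 + z) ^ 2

/-- The sectorial functional calculus `f(A) = e(A)⁻¹ (e f)(A)` of an injective sectorial operator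
`A`, for `f ∈ H^∞(S_φ)`, with its maximal domain. Here `e` is the regularizer `z (1 + z)⁻²`, the
functions `e` and `e f` belong to `H₀^∞(S_φ)`, and `e(A)`, `(e f)(A)` are Cauchy integrals over
the boundary of `S_ν`, where `ν < φ` is larger than the angle of sectoriality of `A`. -/
noncomputable def funcCalc (A : X →ₗ.[ℂ] X) (ν : ℝ) (f : ℂ → ℂ) : X →ₗ.[ℂ] X :=
  compMax ((cauchyInt A ν regularizer).toLinearMap.toPMap ⊤).inverse
    ((cauchyInt A ν fun z => regularizer z * f z).toLinearMap.toPMap ⊤)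

end Operators

/-! ## The operators `-Δ_D + 1` and `M_D` -/

/-- The inhomogeneous Laplacian `-Δ_D + 1 = T_D^* T_D` in `L²(O)^m`. -/
noncomputable def opLap (O : TopologicalSpace.Opens (E n)) (D : Fin m → Set (E n)) :
    L2Pow O (Fin m) →ₗ.[ℂ] L2Pow O (Fin m) :=
  compMax (opT O D).adjoint (opT O D)

/-- The operator `M_D = T_D T_D^*` in `L²(O)^N`. -/
noncomputable def opM (O : TopologicalSpace.Opens (E n)) (D : Fin m → Set (E n)) :
    VField O m →ₗ.[ℂ] VField O m :=
  compMax (opT O D) (opT O D).adjoint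

/-- The closure of the range of `M_D` in `L²(O)^N`. -/
noncomputable def ranM (O : TopologicalSpace.Opens (E n)) (D : Fin m → Set (E n)) :
    Submodule ℂ (VField O m) :=
  (LinearMap.range (opM O D).toFun).topologicalClosure

/-- The injective part of `M_D`, that is, `M_D` restricted to the closure of its range. -/
noncomputable def opMInj (O : TopologicalSpace.Opens (E n)) (D : Fin m → Set (E n)) :
    ranM O D →ₗ.[ℂ] ranM O D :=
  partIn (opM O D) (ranM O D)

end MixedBC

namespace MixedBC

open Complex Set Filter Topology

/-! ## Cauchy's formula on a sector -/

/-! The graph norm of `T = T_D` is the norm of `W^{1,2}`, so the range `S` of `T` is closed and `T`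
is the inverse of the bounded map `V : S → L²(O)^m`, `(F₀, F') ↦ F₀`. Since `D_i ⊆ ∂O`, the domain
of `T` contains the test functions of `O` and is dense. Computing `T^*` in terms of `V` gives `T^* T
= (V V^*)⁻¹ =: A`, `ran (T T^*) = S`, and the part of `T T^*` in `S` is `B := (V^* V)⁻¹`
(`mem_graph_adjoint_comp`, `range_comp_adjoint`, `mem_graph_partIn_comp_adjoint`). So both operators
are inverses of bounded injective positive operators.

Clearly `(z - A)⁻¹ V = V (z - B)⁻¹`, and integration gives `g(A) V = V g(B)` for `g = e, ef`
(`cauchyInt_comp`). If `e(B) w = (ef)(B) y`, applying `V` yields `e(A) V w = (ef)(A) V y`. With `y =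
T u`, `V y = u`, this reads `f(A) u = V w` and `w = f(B) T u`, which is the claim.

It remains to see that `e(A)`, `e(B)` are injective and that `w` exists. For this, the Cauchy
integral is identified with the continuous functional calculus: `g(A) = (s ↦ g(1/s))(A⁻¹)`
(`cauchyInt_eq_cfc`), by the scalar Cauchy formula `cauchy_formula_sector`. On the spectrum `|ef| ≤
M |e|`, hence `‖(ef)(B) x‖ ≤ M ‖e(B) x‖`, and density of `ran e(B)` gives `ran (ef)(B) ⊆ ran e(B)`.
-/

theorem ray_mem_sector {φ θ r : ℝ} (hφ : φ ≤ Real.pi) (hθ : |θ| < φ) (hr : 0 < r) :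
    (r * exp (θ * I) : ℂ) ∈ sector φ := by
  have h := abs_lt.1 hθ
  refine ⟨mul_ne_zero (ofReal_ne_zero.2 hr.ne') (exp_ne_zero _), ?_⟩
  rw [exp_mul_I, arg_mul_cos_add_sin_mul_I hr (by constructor <;> linarith)]
  exact hθ

theorem norm_ray {θ r : ℝ} (hr : 0 ≤ r) : ‖(r * exp (θ * I) : ℂ)‖ = r := by
  rw [norm_mul, norm_exp_ofReal_mul_I, mul_one, norm_real, Real.norm_of_nonneg hr]

theorem isOpen_sector {φ : ℝ} (hφ : φ ≤ Real.pi) : IsOpen (sector φ) := by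
  have h : sector φ = slitPlane ∩ arg ⁻¹' Ioo (-φ) φ := by
    ext z
    simp only [sector, mem_ofPred_eq, mem_inter_iff, mem_preimage, mem_Ioo, ← abs_lt,
      mem_slitPlane_iff_arg]
    constructor
    · rintro ⟨h1, h2⟩
      refine ⟨⟨fun h => ?_, h1⟩, h2⟩
      rw [h, abs_of_pos Real.pi_pos] at h2
      linarith
    · exact fun h => ⟨h.1.2, h.2⟩
  rw [h]
  exact ContinuousOn.isOpen_inter_preimage (fun z hz => (continuousAt_arg hz).continuousWithinAt)
    isOpen_slitPlane isOpen_Ioo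

theorem ofReal_mem_sector {φ t : ℝ} (hφ : 0 < φ) (ht : 0 < t) : (t : ℂ) ∈ sector φ :=
  ⟨ofReal_ne_zero.2 ht.ne', by simpa [arg_ofReal_of_nonneg ht.le] using hφ⟩

/-- The law of cosines as a lower bound for the distance to a point of the positive half axis. -/
theorem sqrt_mul_le_norm_sub {z : ℂ} {c t : ℝ} (hc : c ∈ Ico (-1) 1) (hz : z.re ≤ c * ‖z‖)
    (ht : 0 ≤ t) : √((1 - c) / 2) * (‖z‖ + t) ≤ ‖z - t‖ := by
  have h1 : ‖z - t‖ ^ 2 = ‖z‖ ^ 2 - 2 * t * z.re + t ^ 2 := by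
    rw [← normSq_eq_norm_sq, ← normSq_eq_norm_sq, normSq_apply, normSq_apply]
    simp only [sub_re, ofReal_re, sub_im, ofReal_im]
    ring
  refine abs_le_of_sq_le_sq' ?_ (norm_nonneg _) |>.2
  rw [mul_pow, Real.sq_sqrt (by linarith [hc.2]), h1]
  nlinarith [mul_le_mul_of_nonneg_left hz ht, mul_nonneg (by linarith [hc.1] : 0 ≤ 1 + c)
    (sq_nonneg (‖z‖ - t))]

theorem ray_re {θ r : ℝ} : (r * exp (θ * I) : ℂ).re = r * Real.cos θ := by
  rw [re_ofReal_mul, exp_ofReal_mul_I_re]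

/-- The constant depends only on the angle, through `cos θ < 1`. Uniformity in both `r` and `t` is
what later bounds the resolvent kernel on the whole spectrum. -/
theorem exists_mul_le_norm_ray_sub {θ : ℝ} (h0 : θ ≠ 0) (hθ : |θ| < Real.pi) :
    ∃ k > (0 : ℝ), ∀ r ≥ (0 : ℝ), ∀ t : ℝ, 0 ≤ t → k * (r + t) ≤ ‖(r * exp (θ * I) : ℂ) - t‖ := by
  have hc : Real.cos θ < 1 := by
    rw [← Real.cos_abs, ← Real.cos_zero]
    exact Real.cos_lt_cos_of_nonneg_of_le_pi le_rfl hθ.le (abs_pos.2 h0)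
  refine ⟨√((1 - Real.cos θ) / 2), Real.sqrt_pos.2 (by linarith), fun r hr t ht => ?_⟩
  have h := sqrt_mul_le_norm_sub (z := r * exp (θ * I)) ⟨Real.neg_one_le_cos θ, hc⟩ (t := t)
    (by rw [ray_re, norm_ray hr, mul_comm]) ht
  rwa [norm_ray hr] at h

/-- As `φ < π`, the reflected point `-z` keeps a positive angle from the positive half axis, and
`sqrt_mul_le_norm_sub` applies to `-z` with `t = 1`. -/
theorem exists_mul_le_norm_one_add {φ : ℝ} (hφ : φ ∈ Ioo 0 Real.pi) :
    ∃ k > (0 : ℝ), ∀ z ∈ sector φ, k * (1 + ‖z‖) ≤ ‖1 + z‖ := by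
  have hc : -1 < Real.cos φ := by
    rw [← Real.cos_pi]
    exact Real.cos_lt_cos_of_nonneg_of_le_pi hφ.1.le le_rfl hφ.2
  have hc' : Real.cos φ < 1 := by
    rw [← Real.cos_zero]
    exact Real.cos_lt_cos_of_nonneg_of_le_pi le_rfl hφ.2.le hφ.1
  refine ⟨√((1 - -Real.cos φ) / 2), Real.sqrt_pos.2 (by linarith), fun z hz => ?_⟩
  have h := sqrt_mul_le_norm_sub (z := -z) (c := -Real.cos φ) (t := 1)
    ⟨by linarith, by linarith⟩ (by
      have : Real.cos φ ≤ Real.cos |z.arg| :=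
        Real.cos_le_cos_of_nonneg_of_le_pi (abs_nonneg _) hφ.2.le hz.2.le
      rw [Real.cos_abs] at this
      rw [neg_re, norm_neg, ← norm_mul_cos_arg]
      nlinarith [norm_nonneg z]) zero_le_one
  rw [norm_neg, add_comm ‖z‖] at h
  refine h.trans_eq ?_
  rw [← norm_neg]
  congr 1
  push_cast
  ring

theorem integrable_inv_one_add_sq (C : ℝ) :
    IntegrableOn (fun r : ℝ => C / (1 + r) ^ 2) (Ioi 0) := by
  have h := (integrable_one_add_norm (E := ℝ) (μ := volume) (r := 2) (by simp)).const_mul C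
  refine h.integrableOn.congr_fun (fun r (hr : 0 < r) => ?_) measurableSet_Ioi
  simp only
  rw [Real.norm_of_nonneg hr.le, Real.rpow_neg (by positivity), div_eq_mul_inv]
  norm_cast

theorem continuousOn_ray {φ θ : ℝ} (hφ : φ ≤ Real.pi) (hθ : |θ| < φ) {h : ℂ → ℂ}
    (hh : ContinuousOn h (sector φ)) :
    ContinuousOn (fun r : ℝ => h (r * exp (θ * I))) (Ioi 0) :=
  hh.comp (by fun_prop) fun _ hr => ray_mem_sector hφ hθ hr

theorem integrableOn_ray {φ θ K : ℝ} (hφ : φ ≤ Real.pi) (hθ : |θ| < φ) {h : ℂ → ℂ}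
    (hh : ContinuousOn h (sector φ))
    (hK : ∀ r > (0 : ℝ), ‖h (r * exp (θ * I))‖ ≤ K / (1 + r) ^ 2) :
    IntegrableOn (fun r : ℝ => h (r * exp (θ * I)) * exp (θ * I)) (Ioi 0) := by
  refine Integrable.mono' (integrable_inv_one_add_sq K)
    (((continuousOn_ray hφ hθ hh).mul continuousOn_const).aestronglyMeasurable
      measurableSet_Ioi) ?_
  filter_upwards [ae_restrict_mem measurableSet_Ioi] with r hr
  rw [norm_mul, norm_exp_ofReal_mul_I, mul_one]
  exact hK r hr

theorem exp_line (x θ : ℝ) : exp (x + θ * I) = ((Real.exp x : ℝ) : ℂ) * exp (θ * I) := by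
  rw [exp_add, ofReal_exp]

/-- The substitution `r = e^x` turns the sector into a strip, where rotating a ray means shifting a
horizontal line and Cauchy's theorem for rectangles is available. -/
theorem integral_line_eq_integral_ray {θ : ℝ} (h : ℂ → ℂ) :
    ∫ x : ℝ, h (exp (x + θ * I)) * exp (x + θ * I)
      = ∫ r in Ioi (0 : ℝ), h (r * exp (θ * I)) * exp (θ * I) := by
  have h1 := integral_image_eq_integral_abs_deriv_smul (s := univ) (f := Real.exp)
    (f' := Real.exp) MeasurableSet.univ (fun x _ => (Real.hasDerivAt_exp x).hasDerivWithinAt)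
    Real.exp_injective.injOn (fun r : ℝ => h (r * exp (θ * I)) * exp (θ * I))
  rw [image_univ, Real.range_exp] at h1
  rw [h1, setIntegral_univ]
  refine integral_congr_ae (.of_forall fun x => ?_)
  simp only [exp_line, abs_of_pos (Real.exp_pos x), real_smul]
  ring

theorem integrable_line_iff_integrableOn_ray {θ : ℝ} (h : ℂ → ℂ) :
    IntegrableOn (fun r : ℝ => h (r * exp (θ * I)) * exp (θ * I)) (Ioi 0) ↔
      Integrable (fun x : ℝ => h (exp (x + θ * I)) * exp (x + θ * I)) := by
  have h1 := integrableOn_image_iff_integrableOn_abs_deriv_smul (s := univ) (f := Real.exp)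
    (f' := Real.exp) MeasurableSet.univ (fun x _ => (Real.hasDerivAt_exp x).hasDerivWithinAt)
    Real.exp_injective.injOn (fun r : ℝ => h (r * exp (θ * I)) * exp (θ * I))
  rw [image_univ, Real.range_exp, integrableOn_univ] at h1
  rw [h1]
  refine integrable_congr (.of_forall fun x => ?_)
  simp only [exp_line, abs_of_pos (Real.exp_pos x), real_smul]
  ring

/-- Rotation of rays: the integrals of a holomorphic function over the two boundary rays of a
sector agree, if it decays suitably away from a point `t` of the positive half axis. -/
theorem integral_ray_eq_integral_ray_neg {φ ν t δ K : ℝ} (hφ : φ ≤ Real.pi) (hν : ν ∈ Ioo 0 φ)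
    (hδ : δ < t) {h : ℂ → ℂ} (hh : DifferentiableOn ℂ h (sector φ))
    (hν' : ∀ θ, |θ| = ν → ∀ r > (0 : ℝ), δ ≤ ‖(r * exp (θ * I) : ℂ) - t‖)
    (hK : ∀ z ∈ sector φ, δ ≤ ‖z - t‖ → ‖h z‖ ≤ K / (1 + ‖z‖) ^ 2) (ht : 0 < t) :
    ∫ r in Ioi (0 : ℝ), h (r * exp ((-ν : ℝ) * I)) * exp ((-ν : ℝ) * I)
      = ∫ r in Ioi (0 : ℝ), h (r * exp (ν * I)) * exp (ν * I) := by
  have hab : |ν| = ν := abs_of_pos hν.1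
  have hab' : |-ν| = ν := by rw [abs_neg, hab]
  have key (θ : ℝ) (hθ : |θ| = ν) :
      Integrable (fun x : ℝ => h (exp (x + θ * I)) * exp (x + θ * I)) := by
    have hθ' : |θ| < φ := hθ.symm ▸ hν.2
    rw [← integrable_line_iff_integrableOn_ray]
    refine integrableOn_ray hφ hθ' hh.continuousOn (K := K) fun r hr => ?_
    have := hK _ (ray_mem_sector hφ hθ' hr) (hν' θ hθ r hr)
    rwa [norm_ray hr.le] at this
  rw [← integral_line_eq_integral_ray, ← integral_line_eq_integral_ray]
  have l1 := intervalIntegral_tendsto_integral (key (-ν) hab') tendsto_neg_atTop_atBot tendsto_id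
  have l2 := intervalIntegral_tendsto_integral (key ν hab) tendsto_neg_atTop_atBot tendsto_id
  have hK0 : 0 ≤ K := by
    have h1 := hK _ (ray_mem_sector hφ (θ := ν) (by rw [hab]; exact hν.2) one_pos)
      (hν' ν hab 1 one_pos)
    by_contra hneg
    have : K / (1 + ‖((1 : ℝ) * exp (ν * I) : ℂ)‖) ^ 2 < 0 :=
      div_neg_of_neg_of_pos (not_le.1 hneg) (by positivity)
    linarith [norm_nonneg (h ((1 : ℝ) * exp (ν * I)))]
  -- Away from `|z| = t` the reverse triangle inequality gives `|z - t| ≥ δ`; the decay of `h` times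
  -- the Jacobian `e^x` is then at most a multiple of `e^{-|x|}`, so the vertical sides vanish in
  -- the limit.
  have hside (x y : ℝ) (hy : |y| ≤ ν) (hx : t + δ ≤ Real.exp x ∨ Real.exp x ≤ t - δ) :
      ‖h (exp (x + y * I)) * exp (x + y * I)‖ ≤ K * Real.exp (-|x|) := by
    have hpos := Real.exp_pos x
    have hmem := ray_mem_sector hφ (hy.trans_lt hν.2) hpos
    have hd : δ ≤ ‖((Real.exp x : ℝ) * exp (y * I) : ℂ) - t‖ := by
      have h1 := abs_norm_sub_norm_le ((Real.exp x : ℝ) * exp (y * I) : ℂ) t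
      rw [norm_ray hpos.le, norm_real, Real.norm_of_nonneg ht.le] at h1
      refine le_trans ?_ h1
      rcases hx with hx | hx
      · exact le_trans (by linarith) (le_abs_self _)
      · exact le_trans (by linarith) (neg_le_abs _)
    have h2 := hK _ hmem hd
    rw [norm_ray hpos.le] at h2
    rw [exp_line, norm_mul, norm_ray hpos.le]
    have h3 : Real.exp x / (1 + Real.exp x) ^ 2 ≤ Real.exp (-|x|) := by
      rw [div_le_iff₀ (by positivity)]
      rcases abs_cases x with ⟨hx', -⟩ | ⟨hx', -⟩
      · rw [hx']
        have : Real.exp (-x) * Real.exp x = 1 := by rw [← Real.exp_add]; simp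
        nlinarith [Real.exp_pos (-x)]
      · rw [hx', neg_neg]
        exact le_mul_of_one_le_right hpos.le (by nlinarith)
    calc ‖h ((Real.exp x : ℝ) * exp (y * I))‖ * Real.exp x
        ≤ K / (1 + Real.exp x) ^ 2 * Real.exp x := by gcongr
      _ = K * (Real.exp x / (1 + Real.exp x) ^ 2) := by ring
      _ ≤ _ := by gcongr
  have hint (x : ℝ) (hx : t + δ ≤ Real.exp x ∨ Real.exp x ≤ t - δ) :
      ‖I • ∫ y in (-ν)..ν, h (exp (x + y * I)) * exp (x + y * I)‖
        ≤ K * Real.exp (-|x|) * (2 * ν) := by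
    rw [norm_smul, norm_I, one_mul]
    refine (intervalIntegral.norm_integral_le_of_norm_le_const (C := K * Real.exp (-|x|))
      fun y hy => ?_).trans_eq ?_
    · rw [uIoc_of_le (by linarith [hν.1])] at hy
      exact hside x y (abs_le.2 ⟨hy.1.le, hy.2⟩) hx
    · rw [sub_neg_eq_add, ← two_mul, abs_of_pos (a := 2 * ν) (by linarith [hν.1])]
  have hdiff : Tendsto (fun R : ℝ =>
      (∫ x in (-R)..R, h (exp (x + (-ν : ℝ) * I)) * exp (x + (-ν : ℝ) * I))
        - ∫ x in (-R)..R, h (exp (x + (ν : ℝ) * I)) * exp (x + (ν : ℝ) * I)) atTop (𝓝 0) := by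
    have hz : Tendsto (fun R : ℝ => K * Real.exp (-|R|) * (2 * ν)
        + K * Real.exp (-|-R|) * (2 * ν)) atTop (𝓝 0) := by
      have e : Tendsto (fun R : ℝ => Real.exp (-|R|)) atTop (𝓝 0) :=
        Real.tendsto_exp_atBot.comp (tendsto_neg_atTop_atBot.comp tendsto_abs_atTop_atTop)
      simpa using ((e.const_mul K).mul_const (2 * ν)).add ((e.const_mul K).mul_const (2 * ν))
    refine squeeze_zero_norm' ?_ hz
    -- The hypothesis `δ < t` lets the left side of the rectangle, where `|z| = e^{-R}`, get below
    -- `t - δ`.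
    have hm := (Real.tendsto_exp_atBot.comp tendsto_neg_atTop_atBot).eventually
      (eventually_le_nhds (sub_pos.2 hδ))
    filter_upwards [Real.tendsto_exp_atTop.eventually_ge_atTop (t + δ), hm] with R h1 h2
    have hr := integral_boundary_rect_eq_zero_of_differentiableOn
      (fun w => h (exp w) * exp w) (-R + (-ν : ℝ) * I) (R + ν * I) (by
        refine DifferentiableOn.mul (hh.comp differentiable_exp.differentiableOn ?_)
          differentiable_exp.differentiableOn
        intro w hw
        have hw2 := hw.2
        simp only [mem_preimage, add_im, neg_im, ofReal_im, mul_im, ofReal_re, I_im, I_re,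
          mul_one, mul_zero, add_zero, neg_zero, zero_add] at hw2
        rw [uIcc_of_le (by linarith [hν.1])] at hw2
        have := ray_mem_sector hφ (θ := w.im) ((abs_le.2 hw2).trans_lt hν.2)
          (Real.exp_pos w.re)
        rwa [← exp_line, re_add_im] at this)
    simp only [add_re, neg_re, ofReal_re, mul_re, I_re, I_im, ofReal_im, add_im, neg_im,
      mul_im, mul_zero, mul_one, sub_zero, add_zero, zero_add, neg_zero] at hr
    have e1 : ∀ a b c d : ℂ, a - b + c - d = 0 → a - b = d - c := by
      intro a b c d h
      linear_combination h
    rw [e1 _ _ _ _ hr]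
    refine (norm_sub_le _ _).trans ?_
    rw [add_comm]
    exact add_le_add (hint R (.inl h1)) (hint (-R) (.inr h2))
  exact sub_eq_zero.1 (tendsto_nhds_unique (l1.sub l2) hdiff)

/-- The rational function `(1 + t) / ((1 + z) (z - t))`, integrated over a ray. -/
theorem integral_ray_rational {φ θ t : ℝ} (hφ : φ ≤ Real.pi) (hθ : |θ| < φ) (h0 : θ ≠ 0)
    (ht : 0 < t) :
    IntegrableOn (fun r : ℝ => (1 + t) / ((1 + r * exp (θ * I)) * (r * exp (θ * I) - t))
        * exp (θ * I)) (Ioi 0) ∧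
    ∫ r in Ioi (0 : ℝ), (1 + t) / ((1 + r * exp (θ * I)) * (r * exp (θ * I) - t)) * exp (θ * I)
      = log (-exp (θ * I)) - log (exp (θ * I)) - log t := by
  have hπ : |θ| < Real.pi := hθ.trans_le hφ
  have hsin : (exp (θ * I)).im ≠ 0 := by
    rw [exp_ofReal_mul_I_im]
    have h := abs_lt.1 hπ
    rcases lt_or_gt_of_ne h0 with h' | h'
    · exact (Real.sin_neg_of_neg_of_neg_pi_lt h' h.1).ne
    · exact (Real.sin_pos_of_pos_of_lt_pi h' h.2).ne'
  have him (r : ℝ) (hr : 0 < r) : (r * exp (θ * I)).im ≠ 0 := by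
    rw [im_ofReal_mul]
    exact mul_ne_zero hr.ne' hsin
  have hs1 (r : ℝ) (hr : 0 ≤ r) : (t - r * exp (θ * I) : ℂ) ∈ slitPlane := by
    rcases hr.eq_or_lt with rfl | hr
    · simpa using ht
    · right
      simpa using him r hr
  have hs2 (r : ℝ) (hr : 0 ≤ r) : (1 + r * exp (θ * I) : ℂ) ∈ slitPlane := by
    rcases hr.eq_or_lt with rfl | hr
    · simp
    · right
      simpa using him r hr
  -- Antiderivative `log (t - z) - log (1 + z)`. Off the vertex both arguments are nonreal and at
  -- the vertex they are positive, so the principal branch is never crossed.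
  have hderiv : ∀ r ∈ Ici (0 : ℝ), HasDerivAt
      (fun r : ℝ => log (t - r * exp (θ * I)) - log (1 + r * exp (θ * I)))
      ((1 + t) / ((1 + r * exp (θ * I)) * (r * exp (θ * I) - t)) * exp (θ * I)) r := by
    intro r hr
    have hd : HasDerivAt (fun r : ℝ => (r : ℂ) * exp (θ * I)) (exp (θ * I)) r := by
      simpa using (hasDerivAt_id r).ofReal_comp.mul_const (exp (θ * I))
    have d1 := (hd.const_sub (t : ℂ)).clog_real (hs1 r hr)
    have d2 := (hd.const_add 1).clog_real (hs2 r hr)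
    refine (d1.sub d2).congr_deriv ?_
    have n1 := slitPlane_ne_zero (hs1 r hr)
    have n2 := slitPlane_ne_zero (hs2 r hr)
    have n3 : (r * exp (θ * I) - t : ℂ) ≠ 0 := by
      rw [← neg_sub]
      exact neg_ne_zero.2 n1
    rw [← neg_sub (r * exp (θ * I) : ℂ), neg_div_neg_eq]
    clear d1 d2 hd hs1 hs2
    generalize (r : ℂ) * exp (θ * I) = w at *
    rw [div_sub_div _ _ n3 n2, div_mul_eq_mul_div, mul_comm (1 + w)]
    congr 1
    ring
  obtain ⟨k, hk, hkb⟩ := exists_mul_le_norm_ray_sub h0 hπ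
  obtain ⟨k', hk', hkb'⟩ : ∃ k' > (0 : ℝ), ∀ r > (0 : ℝ), k' * (1 + r) ≤ ‖(1 + r * exp (θ * I) : ℂ)‖ := by
    -- Any half-angle strictly between `|θ|` and `π` serves; this is the midpoint.
    obtain ⟨k, hk, h⟩ := exists_mul_le_norm_one_add (φ := (|θ| + Real.pi) / 2)
      ⟨by linarith [abs_nonneg θ, Real.pi_pos], by linarith⟩
    refine ⟨k, hk, fun r hr => ?_⟩
    have := h _ (ray_mem_sector (θ := θ) (by linarith) (by linarith) hr)
    rwa [norm_ray hr.le] at this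
  have hint : IntegrableOn (fun r : ℝ => (1 + t) / ((1 + r * exp (θ * I)) *
      (r * exp (θ * I) - t)) * exp (θ * I)) (Ioi 0) := by
    refine Integrable.mono' (integrable_inv_one_add_sq ((1 + t) / (k' * (k * min 1 t))))
      (ContinuousOn.aestronglyMeasurable
        (fun r hr => ContinuousAt.continuousWithinAt ?_) measurableSet_Ioi) ?_
    · have n2 := slitPlane_ne_zero (hs2 r (le_of_lt hr))
      have n3 : (r * exp (θ * I) - t : ℂ) ≠ 0 := by
        rw [← neg_sub]
        exact neg_ne_zero.2 (slitPlane_ne_zero (hs1 r (le_of_lt hr)))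
      have hc : Continuous fun r : ℝ => (1 + r * exp (θ * I) : ℂ) * (r * exp (θ * I) - t) := by
        fun_prop
      exact (continuousAt_const.div hc.continuousAt (mul_ne_zero n2 n3)).mul continuousAt_const
    · filter_upwards [ae_restrict_mem measurableSet_Ioi] with r (hr : 0 < r)
      rw [norm_mul, norm_exp_ofReal_mul_I, mul_one, norm_div, norm_mul, div_div]
      have e : ‖(1 + t : ℂ)‖ = 1 + t := by
        rw [← ofReal_one, ← ofReal_add, norm_real, Real.norm_of_nonneg (by linarith)]
      rw [e]
      have hm : 0 < min 1 t := lt_min one_pos ht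
      refine div_le_div_of_nonneg_left (by linarith) (by positivity) ?_
      have a1 := hkb' r hr
      have a2 := hkb r hr.le t ht.le
      have a3 : k * (min 1 t * (1 + r)) ≤ k * (r + t) := by
        refine mul_le_mul_of_nonneg_left ?_ hk.le
        nlinarith [min_le_left 1 t, min_le_right 1 t]
      calc k' * (k * min 1 t) * (1 + r) ^ 2 = (k' * (1 + r)) * (k * (min 1 t * (1 + r))) := by ring
        _ ≤ _ := mul_le_mul a1 (a3.trans a2) (by positivity) (norm_nonneg _)
  refine ⟨hint, ?_⟩
  have hlim : Tendsto (fun r : ℝ => log (t - r * exp (θ * I)) - log (1 + r * exp (θ * I))) atTop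
      (𝓝 (log (-exp (θ * I)) - log (exp (θ * I)))) := by
    have hinv : Tendsto (fun r : ℝ => ((r⁻¹ : ℝ) : ℂ)) atTop (𝓝 0) := by
      rw [← ofReal_zero]
      exact (continuous_ofReal.tendsto 0).comp tendsto_inv_atTop_zero
    have t1 : Tendsto (fun r : ℝ => log (((r⁻¹ : ℝ) : ℂ) * t - exp (θ * I))) atTop
        (𝓝 (log (-exp (θ * I)))) := by
      refine Tendsto.clog ?_ (Or.inr (by simpa using hsin))
      simpa using (hinv.mul_const (t : ℂ)).sub_const (exp (θ * I))
    have t2 : Tendsto (fun r : ℝ => log (((r⁻¹ : ℝ) : ℂ) + exp (θ * I))) atTop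
        (𝓝 (log (exp (θ * I)))) := by
      refine Tendsto.clog ?_ (Or.inr hsin)
      simpa using hinv.add_const (exp (θ * I))
    -- Factoring `r` out of both arguments, the two divergent terms `log r` cancel.
    refine (t1.sub t2).congr' ?_
    filter_upwards [eventually_gt_atTop 0] with r hr
    have hr' : (r : ℂ) ≠ 0 := ofReal_ne_zero.2 hr.ne'
    have e1 : (t - r * exp (θ * I) : ℂ) = r * (((r⁻¹ : ℝ) : ℂ) * t - exp (θ * I)) := by
      push_cast
      field_simp
    have e2 : (1 + r * exp (θ * I) : ℂ) = r * (((r⁻¹ : ℝ) : ℂ) + exp (θ * I)) := by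
      push_cast
      field_simp
    rw [e1, e2, log_ofReal_mul hr, log_ofReal_mul hr]
    · ring
    · intro h
      apply slitPlane_ne_zero (hs2 r hr.le)
      rw [e2, h, mul_zero]
    · intro h
      apply slitPlane_ne_zero (hs1 r hr.le)
      rw [e1, h, mul_zero]
  rw [integral_Ioi_of_hasDerivAt_of_tendsto' hderiv hint hlim]
  simp

/-- Cauchy's formula for a sector and a point `t` of the positive half axis. -/
theorem cauchy_formula_sector {φ ν t C : ℝ} (hφ : φ < Real.pi) (hν : ν ∈ Ioo 0 φ) {g : ℂ → ℂ}
    (hg : DifferentiableOn ℂ g (sector φ)) (hC : ∀ z ∈ sector φ, ‖g z‖ ≤ C / (1 + ‖z‖))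
    (ht : 0 < t) :
    (∫ r in Ioi (0 : ℝ), g (r * exp ((-ν : ℝ) * I)) / (r * exp ((-ν : ℝ) * I) - t)
        * exp ((-ν : ℝ) * I))
      - ∫ r in Ioi (0 : ℝ), g (r * exp (ν * I)) / (r * exp (ν * I) - t) * exp (ν * I)
      = 2 * Real.pi * I * g t := by
  have hφ0 : 0 < φ := hν.1.trans hν.2
  have htm : (t : ℂ) ∈ sector φ := ofReal_mem_sector hφ0 ht
  obtain ⟨k, hk, hk1⟩ := exists_mul_le_norm_one_add ⟨hφ0, hφ⟩
  have hne (z : ℂ) (hz : z ∈ sector φ) : 1 + z ≠ 0 := by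
    intro h
    have := hk1 z hz
    rw [h, norm_zero] at this
    have : 0 < k * (1 + ‖z‖) := by positivity
    linarith
  -- The subtracted multiple of `1 / (1 + z)` has its pole outside the sector, decays as fast as
  -- `g`, and agrees with `g` at `t`. Hence `N / (z - t)` is holomorphic across `t` and of order
  -- `|z|⁻²` at infinity, so its two ray integrals coincide; only the explicit rational part
  -- contributes.
  set N : ℂ → ℂ := fun z => g z - g t * ((1 + t) / (1 + z)) with hN
  have hNd : DifferentiableOn ℂ N (sector φ) := by
    refine hg.sub (DifferentiableOn.const_mul (DifferentiableOn.div (by fun_prop)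
      (by fun_prop) hne) _)
  have hNt : N t = 0 := by
    simp only [hN]
    rw [div_self (hne t htm), mul_one, sub_self]
  have hhd : DifferentiableOn ℂ (dslope N t) (sector φ) :=
    (differentiableOn_dslope ((isOpen_sector hφ.le).mem_nhds htm)).2 hNd
  have hh (z : ℂ) (hz : z ≠ t) : dslope N t z = N z / (z - t) := by
    rw [dslope_of_ne _ hz, slope_def_field, hNt, sub_zero]
  have hC0 : 0 ≤ C := by
    have h1 := hC _ htm
    by_contra hneg
    have : C / (1 + ‖(t : ℂ)‖) < 0 := div_neg_of_neg_of_pos (not_le.1 hneg) (by positivity)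
    linarith [norm_nonneg (g t)]
  set K₁ : ℝ := C + ‖g t‖ * ‖(1 + t : ℂ)‖ / k
  have hNb (z : ℂ) (hz : z ∈ sector φ) : ‖N z‖ ≤ K₁ / (1 + ‖z‖) := by
    refine (norm_sub_le _ _).trans ?_
    rw [show K₁ / (1 + ‖z‖) = C / (1 + ‖z‖) + ‖g t‖ * ‖(1 + t : ℂ)‖ / k / (1 + ‖z‖) from add_div ..]
    refine add_le_add (hC z hz) ?_
    rw [norm_mul, norm_div, mul_div_assoc', div_div]
    refine div_le_div_of_nonneg_left (by positivity) (by positivity) (hk1 z hz)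
  have hab : |ν| = ν := abs_of_pos hν.1
  have habs (θ : ℝ) (hθ : |θ| = ν) : θ ≠ 0 ∧ |θ| < Real.pi ∧ |θ| < φ := by
    refine ⟨?_, by linarith [hν.2], by linarith [hν.2]⟩
    rintro rfl
    simp at hθ
    linarith [hν.1]
  have hdist : ∃ δ > (0 : ℝ), δ < t ∧ ∀ θ, |θ| = ν → ∀ r > (0 : ℝ), δ ≤ ‖(r * exp (θ * I) : ℂ) - t‖ := by
    have hm : |-ν| = ν := by rw [abs_neg, hab]
    obtain ⟨k1, hk1, h1⟩ := exists_mul_le_norm_ray_sub (habs ν hab).1 (habs ν hab).2.1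
    obtain ⟨k2, hk2, h2⟩ := exists_mul_le_norm_ray_sub (habs (-ν) hm).1 (habs (-ν) hm).2.1
    refine ⟨min (min (k1 * t) (k2 * t)) (t / 2), by positivity, ?_, fun θ hθ r hr => ?_⟩
    · exact (min_le_right _ _).trans_lt (by linarith)
    · refine (min_le_left _ _).trans ?_
      rcases (abs_eq hν.1.le).1 hθ with rfl | rfl
      · refine (min_le_left _ _).trans (le_trans ?_ (h1 r hr.le t ht.le))
        nlinarith
      · refine (min_le_right _ _).trans (le_trans ?_ (h2 r hr.le t ht.le))
        nlinarith
  obtain ⟨δ, hδ, hδt, hδν⟩ := hdist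
  have hK₁ : 0 ≤ K₁ := by positivity
  have hhb (z : ℂ) (hz : z ∈ sector φ) (hzt : δ ≤ ‖z - t‖) :
      ‖dslope N t z‖ ≤ K₁ * ((1 + t) / δ + 1) / (1 + ‖z‖) ^ 2 := by
    have hpos : 0 < ‖z - t‖ := hδ.trans_le hzt
    have hzt' : z ≠ t := by
      rintro rfl
      simp at hpos
    rw [hh z hzt', norm_div]
    have h1 : 1 + ‖z‖ ≤ ((1 + t) / δ + 1) * ‖z - t‖ := by
      have a1 : ‖z‖ ≤ ‖z - t‖ + t := by
        have := norm_add_le (z - t) t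
        rwa [sub_add_cancel, norm_real, Real.norm_of_nonneg ht.le] at this
      have a2 : 1 + t ≤ (1 + t) / δ * ‖z - t‖ := by
        rw [div_mul_eq_mul_div, le_div_iff₀ hδ]
        exact mul_le_mul_of_nonneg_left hzt (by linarith)
      linarith
    rw [div_le_div_iff₀ hpos (by positivity)]
    have h2 := hNb z hz
    rw [le_div_iff₀ (by positivity)] at h2
    calc ‖N z‖ * (1 + ‖z‖) ^ 2 = ‖N z‖ * (1 + ‖z‖) * (1 + ‖z‖) := by ring
      _ ≤ K₁ * (((1 + t) / δ + 1) * ‖z - t‖) := mul_le_mul h2 h1 (by positivity) hK₁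
      _ = _ := by ring
  have hrot := integral_ray_eq_integral_ray_neg hφ.le hν hδt hhd hδν hhb ht
  have hsplit (θ : ℝ) (hθ : |θ| = ν) :
      ∫ r in Ioi (0 : ℝ), g (r * exp (θ * I)) / (r * exp (θ * I) - t) * exp (θ * I)
        = (∫ r in Ioi (0 : ℝ), dslope N t (r * exp (θ * I)) * exp (θ * I))
          + g t * (log (-exp (θ * I)) - log (exp (θ * I)) - log t) := by
    obtain ⟨i1, i2⟩ := integral_ray_rational hφ.le (habs θ hθ).2.2 (habs θ hθ).1 ht
    have i3 : IntegrableOn (fun r : ℝ => dslope N t (r * exp (θ * I)) * exp (θ * I)) (Ioi 0) := by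
      refine integrableOn_ray hφ.le (habs θ hθ).2.2 hhd.continuousOn
        (K := K₁ * ((1 + t) / δ + 1)) fun r hr => ?_
      have := hhb _ (ray_mem_sector hφ.le (habs θ hθ).2.2 hr) (hδν θ hθ r hr)
      rwa [norm_ray hr.le] at this
    rw [← i2, ← integral_const_mul, ← integral_add i3 (i1.const_mul _)]
    refine setIntegral_congr_fun measurableSet_Ioi fun r (hr : 0 < r) => ?_
    have hzt : (r * exp (θ * I) : ℂ) - t ≠ 0 := by
      intro h
      have := hδν θ hθ r hr
      rw [h, norm_zero] at this
      linarith
    have hz1 := hne _ (ray_mem_sector hφ.le (habs θ hθ).2.2 hr)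
    rw [hh _ (sub_ne_zero.1 hzt)]
    simp only [hN]
    field_simp
    ring
  have hlog (θ : ℝ) (h1 : -Real.pi < θ) (h2 : θ ≤ Real.pi) : log (exp (θ * I)) = θ * I :=
    log_exp (by simpa using h1) (by simpa using h2)
  rw [hsplit (-ν) (by rw [abs_neg, hab]), hsplit ν hab, hrot,
    hlog ν (by linarith [hν.1, Real.pi_pos]) (by linarith [hν.2]),
    hlog (-ν) (by linarith [hν.2]) (by linarith [hν.1, Real.pi_pos])]
  -- `ν - π` and `π - ν` are the principal arguments of `-e^{iν}` and `-e^{-iν}`. The rays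
  -- contribute `-iπ` and `+iπ`, whose difference is the factor `2πi`.
  have e1 : -exp ((ν : ℝ) * I) = exp ((ν - Real.pi : ℝ) * I) := by
    push_cast
    rw [sub_mul, exp_sub, exp_pi_mul_I, div_neg, div_one]
  have e2 : -exp ((-ν : ℝ) * I) = exp ((-ν + Real.pi : ℝ) * I) := by
    push_cast
    rw [add_mul, exp_add, exp_pi_mul_I, mul_neg, mul_one]
  rw [e1, e2, hlog (ν - Real.pi) (by linarith [hν.1]) (by linarith [hν.2]),
    hlog (-ν + Real.pi) (by linarith [hν.2]) (by linarith [hν.1])]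
  push_cast
  ring

/-! ## Graphs of unbounded operators and resolvents -/

section Graphs

variable {X Y Z : Type*} [NormedAddCommGroup X] [NormedSpace ℂ X] [NormedAddCommGroup Y]
  [NormedSpace ℂ Y] [NormedAddCommGroup Z] [NormedSpace ℂ Z]

/-- In terms of graphs, composition with maximal domain is composition of relations; this removes
the dependent domain proofs from all later arguments. -/
theorem mem_graph_compMax {B : Y →ₗ.[ℂ] Z} {A : X →ₗ.[ℂ] Y} {x : X} {z : Z} :
    (x, z) ∈ (compMax B A).graph ↔ ∃ y, (x, y) ∈ A.graph ∧ (y, z) ∈ B.graph := by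
  have hd : ∀ x : X, ∀ h : x ∈ (compMax B A).domain, ∃ (h₁ : x ∈ A.domain)
      (h₂ : A ⟨x, h₁⟩ ∈ B.domain), compMax B A ⟨x, h⟩ = B ⟨A ⟨x, h₁⟩, h₂⟩ := by
    rintro x ⟨⟨⟨x', h₁⟩, h₂, rfl⟩, h₃⟩
    exact ⟨h₁, h₂, rfl⟩
  constructor
  · intro h
    obtain ⟨y, hy1, hy2⟩ := (LinearPMap.mem_graph_iff _).1 h
    obtain ⟨x', h'⟩ := y
    obtain ⟨h₁, h₂, e⟩ := hd x' h'
    simp only at hy1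
    subst hy1
    refine ⟨A ⟨x', h₁⟩, LinearPMap.mem_graph A ⟨x', h₁⟩, ?_⟩
    have hz : z = B ⟨A ⟨x', h₁⟩, h₂⟩ := hy2.symm.trans e
    rw [hz]
    exact LinearPMap.mem_graph B ⟨_, h₂⟩
  · rintro ⟨y, h1, h2⟩
    obtain ⟨⟨x', hx⟩, e1, e2⟩ := (LinearPMap.mem_graph_iff _).1 h1
    obtain ⟨⟨y', hy⟩, e3, e4⟩ := (LinearPMap.mem_graph_iff _).1 h2
    simp only at e1 e2 e3 e4
    subst e1 e3 e4
    have hA : A ⟨x', hx⟩ ∈ B.domain := by rw [e2]; exact hy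
    have hmem : x' ∈ (compMax B A).domain := ⟨⟨⟨x', hx⟩, hA, rfl⟩, hx⟩
    refine (LinearPMap.mem_graph_iff _).2 ⟨⟨x', hmem⟩, rfl, ?_⟩
    obtain ⟨h₁, h₂, e⟩ := hd x' hmem
    rw [e]
    congr 1
    exact Subtype.ext e2

theorem mem_graph_partIn {A : X →ₗ.[ℂ] X} {S : Submodule ℂ X} {x y : S} :
    (x, y) ∈ (partIn A S).graph ↔ ((x : X), (y : X)) ∈ A.graph := by
  rw [partIn, Submodule.toLinearPMap_graph_eq]
  · rfl
  · rintro ⟨x, y⟩ h h0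
    have h' : ((x : X), (y : X)) ∈ A.graph := h
    exact Subtype.ext (A.graph_fst_eq_zero_snd h' (congrArg Subtype.val h0))

theorem mem_graph_toPMap_top {L : X →L[ℂ] Y} {x : X} {y : Y} :
    (x, y) ∈ (L.toLinearMap.toPMap ⊤).graph ↔ L x = y := by
  simp [LinearPMap.mem_graph_iff]

/-- Injectivity is essential: `LinearPMap.inverse` describes the inverse relation only when that
relation is single-valued. -/
theorem mem_graph_inverse_toPMap_top {L : X →L[ℂ] Y} (hL : Function.Injective L) {x : X} {y : Y} :
    (y, x) ∈ (L.toLinearMap.toPMap ⊤).inverse.graph ↔ L x = y := by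
  rw [LinearPMap.inverse_graph]
  · simp only [Submodule.mem_map, Prod.exists, mem_graph_toPMap_top]
    constructor
    · rintro ⟨a, b, h, e⟩
      cases e
      exact h
    · exact fun h => ⟨x, y, h, rfl⟩
  · rw [LinearMap.ker_eq_bot]
    intro a b h
    exact Subtype.ext (hL h)

theorem mem_graph_funcCalc {A : X →ₗ.[ℂ] X} {ν : ℝ} {f : ℂ → ℂ}
    (hinj : Function.Injective (cauchyInt A ν regularizer)) {x y : X} :
    (x, y) ∈ (funcCalc A ν f).graph ↔
      cauchyInt A ν regularizer y = cauchyInt A ν (fun z => regularizer z * f z) x := by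
  rw [funcCalc, mem_graph_compMax]
  simp only [mem_graph_toPMap_top, mem_graph_inverse_toPMap_top hinj, exists_eq_left']

theorem IsResolventAt.eq {A : X →ₗ.[ℂ] X} {z : ℂ} {R R' : X →L[ℂ] X}
    (h : IsResolventAt A z R) (h' : IsResolventAt A z R') : R = R' := by
  ext y
  obtain ⟨hd, e⟩ := h.2 y
  have h1 := h'.1 ⟨R y, hd⟩
  simp only [e] at h1
  exact h1.symm

theorem IsResolventAt.resolventOp_eq {A : X →ₗ.[ℂ] X} {z : ℂ} {R : X →L[ℂ] X}
    (h : IsResolventAt A z R) : resolventOp A z = R := by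
  have hex : ∃ R, IsResolventAt A z R := ⟨R, h⟩
  rw [resolventOp, dif_pos hex]
  exact hex.choose_spec.eq h

/-- The resolvent of an operator `A` with bounded inverse `P`. -/
theorem isResolventAt_of_inverse {A : X →ₗ.[ℂ] X} {P W : X →L[ℂ] X} {z : ℂ}
    (hA : ∀ x y, (x, y) ∈ A.graph ↔ x = P y) (h1 : W * (z • P - 1) = 1)
    (h2 : (z • P - 1) * W = 1) : IsResolventAt A z (P * W) := by
  constructor
  · intro x
    -- Since `x = P (A x)`, one has `(z - A) x = (z P - 1) A x`, and `P W` undoes this.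
    have hx := (hA _ _).1 (LinearPMap.mem_graph A x)
    have e := congrArg (fun L : X →L[ℂ] X => P (L (A x))) h1
    simp only [mul_apply_eq_comp, sub_apply, smul_apply, one_apply_eq_self, ← hx] at e
    exact e
  · intro y
    have hg : ((P * W) y, W y) ∈ A.graph := (hA _ _).2 rfl
    have hd := LinearPMap.mem_domain_of_mem_graph hg
    refine ⟨hd, ?_⟩
    rw [← (LinearPMap.image_iff hd).2 hg]
    have e := congrArg (fun L : X →L[ℂ] X => L y) h2
    simpa using e

end Graphs

/-! ## The Cauchy integral and the continuous functional calculus -/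

section Hilbert

variable {H : Type*} [NormedAddCommGroup H] [InnerProductSpace ℂ H] [CompleteSpace H]

theorem exists_eq_ofReal_of_mem_spectrum {P : H →L[ℂ] H} (hP : P.IsPositive) {s : ℂ}
    (hs : s ∈ spectrum ℂ P) : ∃ t : ℝ, 0 ≤ t ∧ s = t := by
  have h : s = s.re := hP.isSelfAdjoint.mem_spectrum_eq_re hs
  refine ⟨s.re, ?_, h⟩
  rw [h] at hs
  exact spectrum_nonneg_of_nonneg ((ContinuousLinearMap.nonneg_iff_isPositive P).2 hP)
    (spectrum.of_algebraMap_mem ℂ hs)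

theorem mul_sub_one_ne_zero {z : ℂ} (hz : z.im ≠ 0) (t : ℝ) : z * t - 1 ≠ 0 := by
  intro h
  have h1 := congrArg Complex.im h
  have h2 := congrArg Complex.re h
  simp only [sub_im, im_mul_ofReal, one_im, sub_zero, zero_im, mul_eq_zero, hz, false_or] at h1
  subst h1
  simp at h2

/-- With `s` standing for the inverse spectral variable, `1 / (z - 1/s) = s / (z s - 1)`. This form
is continuous at `s = 0`, which may lie in the spectrum of `P`. -/
theorem isResolventAt_cfc {A : H →ₗ.[ℂ] H} {P : H →L[ℂ] H} (hP : P.IsPositive)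
    (hA : ∀ x y, (x, y) ∈ A.graph ↔ x = P y) {z : ℂ} (hz : z.im ≠ 0) :
    IsResolventAt A z (cfc (fun s : ℂ => s / (z * s - 1)) P) := by
  have hn : IsStarNormal P := hP.isSelfAdjoint.isStarNormal
  have hne : ∀ s ∈ spectrum ℂ P, z * s - 1 ≠ 0 := by
    intro s hs
    obtain ⟨t, -, rfl⟩ := exists_eq_ofReal_of_mem_spectrum hP hs
    exact mul_sub_one_ne_zero hz t
  have hc : ContinuousOn (fun s : ℂ => (z * s - 1)⁻¹) (spectrum ℂ P) :=
    ContinuousOn.inv₀ (by fun_prop) hne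
  have hc' : ContinuousOn (fun s : ℂ => z * s - 1) (spectrum ℂ P) := by fun_prop
  have hp : z • P - 1 = cfc (fun s : ℂ => z * s - 1) P := by
    rw [cfc_sub (fun s => z * s) (fun _ => 1) P (by fun_prop) (by fun_prop),
      cfc_const_mul_id z P hn, cfc_const_one ℂ P hn]
  have h1 : cfc (fun s : ℂ => (z * s - 1)⁻¹) P * (z • P - 1) = 1 := by
    rw [hp, ← cfc_mul _ _ P hc hc', ← cfc_const_one ℂ P hn]
    exact cfc_congr fun s hs => inv_mul_cancel₀ (hne s hs)
  have h2 : (z • P - 1) * cfc (fun s : ℂ => (z * s - 1)⁻¹) P = 1 := by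
    rw [hp, ← cfc_mul _ _ P hc' hc, ← cfc_const_one ℂ P hn]
    exact cfc_congr fun s hs => mul_inv_cancel₀ (hne s hs)
  have h := isResolventAt_of_inverse hA h1 h2
  have e : P * cfc (fun s : ℂ => (z * s - 1)⁻¹) P = cfc (fun s : ℂ => s / (z * s - 1)) P :=
    calc P * cfc (fun s : ℂ => (z * s - 1)⁻¹) P
        = cfc (fun s : ℂ => s) P * cfc (fun s : ℂ => (z * s - 1)⁻¹) P := by rw [cfc_id' ℂ P hn]
      _ = _ := (cfc_mul (fun s => s) _ P (continuousOn_id' _) hc).symm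
  rwa [e] at h

theorem resolventOp_eq_cfc {A : H →ₗ.[ℂ] H} {P : H →L[ℂ] H} (hP : P.IsPositive)
    (hA : ∀ x y, (x, y) ∈ A.graph ↔ x = P y) {z : ℂ} (hz : z.im ≠ 0) :
    resolventOp A z = cfc (fun s : ℂ => s / (z * s - 1)) P :=
  (isResolventAt_cfc hP hA hz).resolventOp_eq

theorem isResolventAt_resolventOp {A : H →ₗ.[ℂ] H} {P : H →L[ℂ] H} (hP : P.IsPositive)
    (hA : ∀ x y, (x, y) ∈ A.graph ↔ x = P y) {z : ℂ} (hz : z.im ≠ 0) :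
    IsResolventAt A z (resolventOp A z) := by
  rw [resolventOp_eq_cfc hP hA hz]
  exact isResolventAt_cfc hP hA hz

end Hilbert

/-! ### Cauchy integrals as continuous functions of the bounded inverse -/

section CauchyCfc

/-- The functions of class `H₀^∞(S_φ)` that decay like the regularizer `z (1 + z)⁻²`. -/
structure IsDecaying (φ C : ℝ) (g : ℂ → ℂ) : Prop where
  holomorphic : DifferentiableOn ℂ g (sector φ)
  bound : ∀ z ∈ sector φ, ‖g z‖ ≤ C * ‖z‖ / (1 + ‖z‖) ^ 2
  -- The symbol `g s⁻¹` at `s = 0` evaluates `g` at `0⁻¹ = 0`; this value has to be the limit of `g`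
  -- at infinity.
  zero : g 0 = 0
  nonneg : 0 ≤ C

theorem IsDecaying.bound_inv {φ C : ℝ} {g : ℂ → ℂ} (hg : IsDecaying φ C g) {z : ℂ}
    (hz : z ∈ sector φ) : ‖g z‖ ≤ C / (1 + ‖z‖) := by
  refine (hg.bound z hz).trans ?_
  rw [div_le_div_iff₀ (by positivity) (by positivity)]
  have := hg.nonneg
  have h : ‖z‖ * (1 + ‖z‖) ≤ (1 + ‖z‖) ^ 2 := by nlinarith [norm_nonneg z]
  calc C * ‖z‖ * (1 + ‖z‖) = C * (‖z‖ * (1 + ‖z‖)) := by ring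
    _ ≤ _ := by gcongr

/-- The symbol, in terms of the inverse `s` of the spectral variable, of
`g(z) (z - A)⁻¹ dz` on the ray of angle `θ`. -/
noncomputable def rayKernel (g : ℂ → ℂ) (θ r : ℝ) (s : ℂ) : ℂ :=
  g (r * exp (θ * I)) * exp (θ * I) * (s / (r * exp (θ * I) * s - 1))

theorem ray_im_ne_zero {θ r : ℝ} (h0 : θ ≠ 0) (hθ : |θ| < Real.pi) (hr : 0 < r) :
    (r * exp (θ * I) : ℂ).im ≠ 0 := by
  rw [im_ofReal_mul, exp_ofReal_mul_I_im]
  refine mul_ne_zero hr.ne' ?_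
  have h := abs_lt.1 hθ
  rcases lt_or_gt_of_ne h0 with h' | h'
  · exact (Real.sin_neg_of_neg_of_neg_pi_lt h' h.1).ne
  · exact (Real.sin_pos_of_pos_of_lt_pi h' h.2).ne'

variable {φ C θ : ℝ} {g : ℂ → ℂ}

theorem continuousOn_rayKernel (hφ : φ ≤ Real.pi) (hg : IsDecaying φ C g) (h0 : θ ≠ 0)
    (hθ : |θ| < φ) {S : Set ℂ} (hS : ∀ s ∈ S, ∃ t : ℝ, 0 ≤ t ∧ s = t) :
    ContinuousOn (Function.uncurry (rayKernel g θ)) (Ioi 0 ×ˢ S) := by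
  have h1 : ContinuousOn (fun p : ℝ × ℂ => g (p.1 * exp (θ * I))) (Ioi 0 ×ˢ S) :=
    (continuousOn_ray hφ hθ hg.holomorphic.continuousOn).comp continuousOn_fst fun p hp => hp.1
  have h2 : ContinuousOn (fun p : ℝ × ℂ => p.2 / (p.1 * exp (θ * I) * p.2 - 1)) (Ioi 0 ×ˢ S) := by
    refine ContinuousOn.div (by fun_prop) (by fun_prop) ?_
    rintro ⟨r, s⟩ ⟨hr, hs⟩
    obtain ⟨t, -, rfl⟩ := hS s hs
    exact mul_sub_one_ne_zero (ray_im_ne_zero h0 (hθ.trans_le hφ) hr) t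
  exact (h1.mul continuousOn_const).mul h2

/-- For `t > 0` the resolvent factor is `1 / (z - 1/t)`, of size at most `1 / (k r)` uniformly in
`t`. The first-order decay of `g` at the origin absorbs `1 / r`, leaving an integrable majorant
independent of the spectral point. -/
theorem exists_norm_rayKernel_le (hφ : φ ≤ Real.pi) (hg : IsDecaying φ C g) (h0 : θ ≠ 0)
    (hθ : |θ| < φ) : ∃ K : ℝ, ∀ r > (0 : ℝ), ∀ t : ℝ, 0 ≤ t →
      ‖rayKernel g θ r t‖ ≤ K / (1 + r) ^ 2 := by
  obtain ⟨k, hk, h⟩ := exists_mul_le_norm_ray_sub h0 (hθ.trans_le hφ)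
  refine ⟨C / k, fun r hr t ht => ?_⟩
  have hC := hg.nonneg
  have h1 := hg.bound _ (ray_mem_sector hφ hθ hr)
  rw [norm_ray hr.le] at h1
  have h2 : ‖(t / (r * exp (θ * I) * t - 1) : ℂ)‖ ≤ 1 / (k * r) := by
    rcases ht.eq_or_lt with rfl | ht
    · simp only [ofReal_zero, zero_div, norm_zero]
      positivity
    · have e : (t / (r * exp (θ * I) * t - 1) : ℂ) = (r * exp (θ * I) - (t⁻¹ : ℝ))⁻¹ := by
        have ht' : (t : ℂ) ≠ 0 := ofReal_ne_zero.2 ht.ne'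
        have e' : (r * exp (θ * I) * t - 1 : ℂ) = (r * exp (θ * I) - (t⁻¹ : ℝ)) * t := by
          push_cast
          field_simp
        rw [e', div_mul_cancel_right₀ ht']
      rw [e, norm_inv, one_div]
      refine inv_anti₀ (by positivity) (le_trans ?_ (h r hr.le t⁻¹ (by positivity)))
      have : 0 < t⁻¹ := by positivity
      nlinarith
  rw [rayKernel, norm_mul, norm_mul, norm_exp_ofReal_mul_I, mul_one]
  calc _ ≤ C * r / (1 + r) ^ 2 * (1 / (k * r)) := mul_le_mul h1 h2 (norm_nonneg _) (by positivity)
    _ = _ := by field_simp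

theorem integrableOn_rayKernel (hφ : φ ≤ Real.pi) (hg : IsDecaying φ C g) (h0 : θ ≠ 0)
    (hθ : |θ| < φ) {t : ℝ} (ht : 0 ≤ t) :
    IntegrableOn (fun r => rayKernel g θ r t) (Ioi 0) := by
  obtain ⟨K, hK⟩ := exists_norm_rayKernel_le hφ hg h0 hθ
  have hc := continuousOn_rayKernel hφ hg h0 hθ (S := {(t : ℂ)})
    (fun s hs => ⟨t, ht, hs⟩)
  have hc' : ContinuousOn (fun r => rayKernel g θ r t) (Ioi 0) :=
    hc.comp (f := fun r : ℝ => (r, (t : ℂ))) (by fun_prop) fun r hr => ⟨hr, rfl⟩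
  refine Integrable.mono' (integrable_inv_one_add_sq K)
    (hc'.aestronglyMeasurable measurableSet_Ioi) ?_
  filter_upwards [ae_restrict_mem measurableSet_Ioi] with r hr
  exact hK r hr t ht

/-- This is Cauchy's formula at the point `1/t`; at `t = 0` the kernel vanishes, and so does `g 0⁻¹
= g 0`. -/
theorem integral_rayKernel_sub {ν t : ℝ} (hφ : φ < Real.pi) (hν : ν ∈ Ioo 0 φ)
    (hg : IsDecaying φ C g) (ht : 0 ≤ t) :
    ∫ r in Ioi (0 : ℝ), (rayKernel g (-ν) r t - rayKernel g ν r t)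
      = 2 * Real.pi * I * g (t : ℂ)⁻¹ := by
  rcases ht.eq_or_lt with rfl | ht
  · simp [rayKernel, hg.zero]
  have hab : |ν| = ν := abs_of_pos hν.1
  rw [integral_sub (integrableOn_rayKernel hφ.le hg (neg_ne_zero.2 hν.1.ne')
      (by rw [abs_neg, hab]; exact hν.2) ht.le)
    (integrableOn_rayKernel hφ.le hg hν.1.ne' (by rw [hab]; exact hν.2) ht.le)]
  rw [← ofReal_inv, ← cauchy_formula_sector hφ hν hg.holomorphic (fun z => hg.bound_inv)
    (inv_pos.2 ht)]
  have e (θ r : ℝ) : rayKernel g θ r t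
      = g (r * exp (θ * I)) / (r * exp (θ * I) - (t⁻¹ : ℝ)) * exp (θ * I) := by
    have ht' : (t : ℂ) ≠ 0 := ofReal_ne_zero.2 ht.ne'
    have e' : (r * exp (θ * I) * t - 1 : ℂ) = (r * exp (θ * I) - (t⁻¹ : ℝ)) * t := by
      push_cast
      field_simp
    rw [rayKernel, e', div_mul_cancel_right₀ ht']
    ring
  simp only [e]

variable {H : Type*} [NormedAddCommGroup H] [InnerProductSpace ℂ H] [CompleteSpace H]
  {A : H →ₗ.[ℂ] H} {P : H →L[ℂ] H}

theorem smul_resolventOp_ray (hφ : φ ≤ Real.pi) (hP : P.IsPositive)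
    (hA : ∀ x y, (x, y) ∈ A.graph ↔ x = P y) (h0 : θ ≠ 0) (hθ : |θ| < φ) {r : ℝ} (hr : 0 < r) :
    (g (r * exp (θ * I)) * exp (θ * I)) • resolventOp A (r * exp (θ * I))
      = cfc (rayKernel g θ r) P := by
  have hz := ray_im_ne_zero h0 (hθ.trans_le hφ) hr
  have hc : ContinuousOn (fun s : ℂ => s / (r * exp (θ * I) * s - 1)) (spectrum ℂ P) := by
    refine ContinuousOn.div (by fun_prop) (by fun_prop) fun s hs => ?_
    obtain ⟨t, -, rfl⟩ := exists_eq_ofReal_of_mem_spectrum hP hs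
    exact mul_sub_one_ne_zero hz t
  rw [resolventOp_eq_cfc hP hA hz, ← cfc_const_mul _ _ P hc]
  rfl

theorem integrableOn_cfc_rayKernel (hφ : φ ≤ Real.pi) (hg : IsDecaying φ C g) (hP : P.IsPositive)
    (h0 : θ ≠ 0) (hθ : |θ| < φ) :
    IntegrableOn (fun r => cfc (rayKernel g θ r) P) (Ioi 0) := by
  obtain ⟨K, hK⟩ := exists_norm_rayKernel_le hφ hg h0 hθ
  refine integrableOn_cfc measurableSet_Ioi _ (fun r => K / (1 + r) ^ 2) P
    (continuousOn_rayKernel hφ hg h0 hθ fun s => exists_eq_ofReal_of_mem_spectrum hP) ?_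
    (integrable_inv_one_add_sq K).2 hP.isSelfAdjoint.isStarNormal
  filter_upwards [ae_restrict_mem measurableSet_Ioi] with r hr s hs
  obtain ⟨t, ht, rfl⟩ := exists_eq_ofReal_of_mem_spectrum hP hs
  exact hK r hr t ht

theorem integrableOn_smul_resolventOp (hφ : φ ≤ Real.pi) (hg : IsDecaying φ C g)
    (hP : P.IsPositive) (hA : ∀ x y, (x, y) ∈ A.graph ↔ x = P y) (h0 : θ ≠ 0) (hθ : |θ| < φ) :
    IntegrableOn (fun r : ℝ => (g (r * exp (θ * I)) * exp (θ * I)) •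
      resolventOp A (r * exp (θ * I))) (Ioi 0) :=
  (integrableOn_cfc_rayKernel hφ hg hP h0 hθ).congr_fun
    (fun _ hr => (smul_resolventOp_ray hφ hP hA h0 hθ hr).symm) measurableSet_Ioi

theorem cauchyInt_eq_integral_ray {X : Type*} [NormedAddCommGroup X] [NormedSpace ℂ X]
    (A : X →ₗ.[ℂ] X) (ν : ℝ) (g : ℂ → ℂ) :
    cauchyInt A ν g = (2 * Real.pi * I)⁻¹ •
      ((∫ r in Ioi (0 : ℝ), (g (r * exp ((-ν : ℝ) * I)) * exp ((-ν : ℝ) * I)) •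
          resolventOp A (r * exp ((-ν : ℝ) * I)))
        - ∫ r in Ioi (0 : ℝ), (g (r * exp (ν * I)) * exp (ν * I)) •
          resolventOp A (r * exp (ν * I))) := by
  simp only [cauchyInt, ofReal_neg, neg_mul]

/-- The Cauchy integral of `g` over the boundary of a sector is `g(A)`, in the sense of the
continuous functional calculus of the bounded inverse `P` of `A`. -/
theorem cauchyInt_eq_cfc {ν : ℝ} (hφ : φ < Real.pi) (hν : ν ∈ Ioo 0 φ) (hg : IsDecaying φ C g)
    (hP : P.IsPositive) (hA : ∀ x y, (x, y) ∈ A.graph ↔ x = P y) :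
    cauchyInt A ν g = cfc (fun s => g s⁻¹) P := by
  have hab : |ν| < φ := by rw [abs_of_pos hν.1]; exact hν.2
  have hab' : |-ν| < φ := by rwa [abs_neg]
  have hn : -ν ≠ 0 := neg_ne_zero.2 hν.1.ne'
  have hsp : ∀ s ∈ spectrum ℂ P, ∃ t : ℝ, 0 ≤ t ∧ s = t :=
    fun s => exists_eq_ofReal_of_mem_spectrum hP
  have hnorm : IsStarNormal P := hP.isSelfAdjoint.isStarNormal
  rw [cauchyInt_eq_integral_ray,
    setIntegral_congr_fun measurableSet_Ioi
      (fun r hr => smul_resolventOp_ray hφ.le hP hA hn hab' hr),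
    setIntegral_congr_fun measurableSet_Ioi
      (fun r hr => smul_resolventOp_ray hφ.le hP hA hν.1.ne' hab hr),
    ← integral_sub (integrableOn_cfc_rayKernel hφ.le hg hP hn hab')
      (integrableOn_cfc_rayKernel hφ.le hg hP hν.1.ne' hab), ← integral_smul]
  obtain ⟨K, hK⟩ := exists_norm_rayKernel_le hφ.le hg hn hab'
  obtain ⟨K', hK'⟩ := exists_norm_rayKernel_le hφ.le hg hν.1.ne' hab
  have c1 := continuousOn_rayKernel hφ.le hg hn hab' hsp
  have c2 := continuousOn_rayKernel hφ.le hg hν.1.ne' hab hsp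
  have hslice (h : ℝ → ℂ → ℂ) (hh : ContinuousOn (Function.uncurry h) (Ioi 0 ×ˢ spectrum ℂ P))
      (r : ℝ) (hr : 0 < r) : ContinuousOn (h r) (spectrum ℂ P) :=
    hh.comp (f := fun s : ℂ => (r, s)) (by fun_prop) fun s hs => ⟨hr, hs⟩
  have key : ∀ r ∈ Ioi (0 : ℝ), (2 * Real.pi * I : ℂ)⁻¹ •
      (cfc (rayKernel g (-ν) r) P - cfc (rayKernel g ν r) P)
        = cfc (fun s => (2 * Real.pi * I : ℂ)⁻¹ * (rayKernel g (-ν) r s - rayKernel g ν r s)) P := by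
    intro r hr
    rw [cfc_const_mul _ (fun s => rayKernel g (-ν) r s - rayKernel g ν r s) P
        ((hslice _ c1 r hr).sub (hslice _ c2 r hr)), cfc_sub _ _ P (hslice _ c1 r hr) (hslice _ c2 r hr)]
  -- The uniform majorant allows the integral over the ray to pass inside the functional calculus,
  -- which reduces the claim to scalars on the spectrum.
  rw [setIntegral_congr_fun measurableSet_Ioi key, ← cfc_setIntegral measurableSet_Ioi
    (fun r s => (2 * Real.pi * I : ℂ)⁻¹ * (rayKernel g (-ν) r s - rayKernel g ν r s))
    (fun r => ‖(2 * Real.pi * I : ℂ)⁻¹‖ * (K / (1 + r) ^ 2 + K' / (1 + r) ^ 2)) P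
    (continuousOn_const.mul (c1.sub c2)) ?_
    (((integrable_inv_one_add_sq K).add (integrable_inv_one_add_sq K')).const_mul _).2 hnorm]
  · refine cfc_congr fun s hs => ?_
    obtain ⟨t, ht, rfl⟩ := hsp s hs
    rw [integral_const_mul, integral_rayKernel_sub hφ hν hg ht, inv_mul_cancel_left₀]
    exact two_pi_I_ne_zero
  · filter_upwards [ae_restrict_mem measurableSet_Ioi] with r hr s hs
    obtain ⟨t, ht, rfl⟩ := hsp s hs
    rw [norm_mul]
    gcongr
    exact (norm_sub_le _ _).trans (add_le_add (hK r hr t ht) (hK' r hr t ht))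

/-- Only `s = 0` needs an argument: there the decay of `g` at infinity becomes `|g(1/s)| ≤ C |s|`.
-/
theorem IsDecaying.continuousOn_comp_inv (hφ : 0 < φ) (hφ' : φ ≤ Real.pi) (hg : IsDecaying φ C g)
    {S : Set ℂ} (hS : ∀ s ∈ S, ∃ t : ℝ, 0 ≤ t ∧ s = t) :
    ContinuousOn (fun s => g s⁻¹) S := by
  intro s hs
  obtain ⟨t, ht, rfl⟩ := hS s hs
  rcases ht.eq_or_lt with rfl | ht
  · have hb : ∀ s ∈ S, ‖g s⁻¹‖ ≤ C * ‖s‖ := by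
      intro s hs
      obtain ⟨t, ht, rfl⟩ := hS s hs
      rcases ht.eq_or_lt with rfl | ht
      · simp [hg.zero]
      · rw [← ofReal_inv]
        refine (hg.bound _ (ofReal_mem_sector hφ (inv_pos.2 ht))).trans ?_
        rw [norm_real, norm_real, Real.norm_of_nonneg ht.le, Real.norm_of_nonneg (inv_pos.2 ht).le,
          mul_div_assoc]
        refine mul_le_mul_of_nonneg_left ?_ hg.nonneg
        rw [div_le_iff₀ (by positivity)]
        have : t * t⁻¹ = 1 := mul_inv_cancel₀ ht.ne'
        have h3 := inv_pos.2 ht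
        nlinarith [mul_pos ht h3, mul_pos ht (mul_pos h3 h3)]
    rw [ContinuousWithinAt, ofReal_zero, inv_zero, hg.zero]
    refine squeeze_zero_norm' (a := fun s : ℂ => C * ‖s‖) ?_ ?_
    · filter_upwards [self_mem_nhdsWithin] with s hs using hb s hs
    · have : Tendsto (fun s : ℂ => C * ‖s‖) (𝓝 0) (𝓝 (C * ‖(0 : ℂ)‖)) :=
        (continuous_const.mul continuous_norm).tendsto 0
      rw [norm_zero, mul_zero] at this
      exact this.mono_left nhdsWithin_le_nhds
  · refine ContinuousAt.continuousWithinAt ?_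
    have hm : ((t : ℂ))⁻¹ ∈ sector φ := by
      rw [← ofReal_inv]
      exact ofReal_mem_sector hφ (inv_pos.2 ht)
    have h1 : ContinuousAt g ((t : ℂ))⁻¹ :=
      hg.holomorphic.continuousOn.continuousAt ((isOpen_sector hφ').mem_nhds hm)
    exact ContinuousAt.comp (f := fun s : ℂ => s⁻¹) h1
      (continuousAt_inv₀ (ofReal_ne_zero.2 ht.ne'))

theorem norm_regularizer_le {φ : ℝ} (hφ : φ ∈ Ioo 0 Real.pi) : ∃ C : ℝ, 0 ≤ C ∧
    ∀ z ∈ sector φ, 1 + z ≠ 0 ∧ ‖regularizer z‖ ≤ C * ‖z‖ / (1 + ‖z‖) ^ 2 := by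
  obtain ⟨k, hk, h⟩ := exists_mul_le_norm_one_add hφ
  refine ⟨1 / k ^ 2, by positivity, fun z hz => ?_⟩
  have h1 := h z hz
  refine ⟨fun h0 => ?_, ?_⟩
  · rw [h0, norm_zero] at h1
    have : 0 < k * (1 + ‖z‖) := by positivity
    linarith
  · rw [regularizer, norm_div, norm_pow]
    calc ‖z‖ / ‖1 + z‖ ^ 2 ≤ ‖z‖ / (k * (1 + ‖z‖)) ^ 2 := by gcongr
      _ = _ := by
        rw [mul_pow]
        field_simp

theorem IsHInfty.isDecaying_regularizer_mul (hφ : φ ∈ Ioo 0 Real.pi) {f : ℂ → ℂ}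
    (hf : IsHInfty φ f) : ∃ C, IsDecaying φ C fun z => regularizer z * f z := by
  obtain ⟨C, hC, h⟩ := norm_regularizer_le hφ
  obtain ⟨M, hM⟩ := hf.bounded
  refine ⟨C * |M|, ?_, fun z hz => ?_, by simp [regularizer], by positivity⟩
  · refine DifferentiableOn.mul (DifferentiableOn.div (by fun_prop) (by fun_prop) fun z hz => ?_)
      hf.holomorphic
    exact pow_ne_zero _ (h z hz).1
  · rw [norm_mul]
    calc _ ≤ C * ‖z‖ / (1 + ‖z‖) ^ 2 * |M| :=
        mul_le_mul (h z hz).2 ((hM z hz).trans (le_abs_self M)) (norm_nonneg _) (by positivity)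
      _ = _ := by ring

theorem exists_isDecaying_regularizer (hφ : φ ∈ Ioo 0 Real.pi) :
    ∃ C, IsDecaying φ C regularizer := by
  have h : IsHInfty φ fun _ => 1 := ⟨differentiableOn_const _, 1, by simp⟩
  simpa using h.isDecaying_regularizer_mul hφ

end CauchyCfc

/-! ### Solvability of the regularized equation and intertwining by `V` -/

section Abstract

variable {φ ν C : ℝ} {g : ℂ → ℂ}
variable {H : Type*} [NormedAddCommGroup H] [InnerProductSpace ℂ H] [CompleteSpace H]

/-- Domination of symbols on the spectrum implies pointwise domination of the operators. -/
theorem norm_cfc_apply_le {P : H →L[ℂ] H} {C : ℝ} {g h : ℂ → ℂ}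
    (hg : ContinuousOn g (spectrum ℂ P)) (hh : ContinuousOn h (spectrum ℂ P))
    (hgh : ∀ s ∈ spectrum ℂ P, ‖g s‖ ^ 2 ≤ C ^ 2 * ‖h s‖ ^ 2) (x : H) :
    ‖cfc g P x‖ ^ 2 ≤ C ^ 2 * ‖cfc h P x‖ ^ 2 := by
  -- Chosen so that `|g|² + |q|² = C² |h|²`; this identity of symbols becomes `‖g(P)x‖² + ‖q(P)x‖² =
  -- C² ‖h(P)x‖²`.
  set q : ℂ → ℂ := fun s => (√(C ^ 2 * ‖h s‖ ^ 2 - ‖g s‖ ^ 2) : ℝ) with hq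
  have hqc : ContinuousOn q (spectrum ℂ P) := by
    refine continuous_ofReal.comp_continuousOn (ContinuousOn.sqrt ?_)
    exact (continuousOn_const.mul (hh.norm.pow 2)).sub (hg.norm.pow 2)
  have hsq (k : ℂ → ℂ) (hk : ContinuousOn k (spectrum ℂ P)) :
      ((‖cfc k P x‖ ^ 2 : ℝ) : ℂ) = inner ℂ (cfc (fun s => star (k s) * k s) P x) x := by
    rw [cfc_mul (fun s => star (k s)) k P hk.star hk, cfc_star, mul_apply_eq_comp,
      ContinuousLinearMap.star_eq_adjoint, ContinuousLinearMap.adjoint_inner_left,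
      inner_self_eq_norm_sq_to_K]
    simp
  have hkc (k : ℂ → ℂ) (hk : ContinuousOn k (spectrum ℂ P)) :
      ContinuousOn (fun s => star (k s) * k s) (spectrum ℂ P) := hk.star.mul hk
  have hsum : cfc (fun s => ((C ^ 2 : ℝ) : ℂ) * (star (h s) * h s)) P
      = cfc (fun s => star (g s) * g s) P + cfc (fun s => star (q s) * q s) P := by
    rw [← cfc_add P _ _ (hkc g hg) (hkc q hqc)]
    refine cfc_congr fun s hs => ?_
    have e (z : ℂ) : star z * z = ((‖z‖ ^ 2 : ℝ) : ℂ) := by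
      rw [star_def, conj_mul']
      push_cast
      rfl
    simp only [e, ← ofReal_mul, ← ofReal_add]
    congr 1
    simp only [hq, norm_real, Real.norm_of_nonneg (Real.sqrt_nonneg _)]
    rw [Real.sq_sqrt (by linarith [hgh s hs])]
    ring
  rw [cfc_const_mul _ _ P (hkc h hh)] at hsum
  have hfin : ((C ^ 2 * ‖cfc h P x‖ ^ 2 : ℝ) : ℂ)
      = ((‖cfc g P x‖ ^ 2 + ‖cfc q P x‖ ^ 2 : ℝ) : ℂ) := by
    rw [ofReal_mul, ofReal_add, hsq h hh, hsq g hg, hsq q hqc, ← inner_add_left,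
      ← add_apply, ← hsum, smul_apply, inner_smul_left, conj_ofReal]
  have := ofReal_injective hfin
  nlinarith [sq_nonneg ‖cfc q P x‖]

/-- If `E` is injective, self-adjoint and dominates `S`, with which it commutes, then the range of
`S` is contained in that of `E`. -/
theorem exists_apply_eq_of_norm_le {E S : H →L[ℂ] H} (hE : IsSelfAdjoint E)
    (hinj : Function.Injective E) (hES : E * S = S * E) {C : ℝ} (hC : 0 ≤ C)
    (hb : ∀ x, ‖S x‖ ≤ C * ‖E x‖) (y : H) : ∃ w, E w = S y := by
  have hdense : DenseRange E := by
    rw [DenseRange]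
    have h1 : (LinearMap.range E.toLinearMap)ᗮ = ⊥ := by
      rw [ContinuousLinearMap.orthogonal_range, ← ContinuousLinearMap.star_eq_adjoint, hE.star_eq]
      exact LinearMap.ker_eq_bot.2 hinj
    have h2 := Submodule.topologicalClosure_eq_top_iff.2 h1
    have h3 := Submodule.dense_iff_topologicalClosure_eq_top.2 h2
    have h4 : ((LinearMap.range E.toLinearMap : Submodule ℂ H) : Set H) = range E := rfl
    rwa [h4] at h3
  -- Approximate `y` by `E x_k`. Domination makes `S x_k` Cauchy, and its limit `w` satisfies `E w =
  -- lim E S x_k = lim S E x_k = S y`.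
  obtain ⟨v, hv, hvy⟩ := mem_closure_iff_seq_limit.1 (hdense y)
  choose x hx using hv
  have hcomm (z : H) : E (S z) = S (E z) := congrArg (fun L : H →L[ℂ] H => L z) hES
  have hcauchy : CauchySeq fun k => S (x k) := by
    have hc := hvy.cauchySeq
    rw [Metric.cauchySeq_iff'] at hc ⊢
    intro ε hε
    obtain ⟨N, hN⟩ := hc (ε / (C + 1)) (by positivity)
    refine ⟨N, fun k hk => ?_⟩
    have h1 := hN k hk
    rw [dist_eq_norm, ← hx, ← hx, ← map_sub] at h1
    rw [dist_eq_norm, ← map_sub]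
    refine (hb _).trans_lt ?_
    rw [lt_div_iff₀ (by positivity)] at h1
    nlinarith [norm_nonneg (E (x k - x N))]
  obtain ⟨w, hw⟩ := cauchySeq_tendsto_of_complete hcauchy
  refine ⟨w, tendsto_nhds_unique ((E.continuous.tendsto w).comp hw) ?_⟩
  refine ((S.continuous.tendsto y).comp hvy).congr fun k => ?_
  simp only [Function.comp, hcomm, hx]

theorem regularizer_inv {t : ℝ} (ht : 0 ≤ t) :
    regularizer (t : ℂ)⁻¹ = (t : ℂ) * ((1 + t : ℂ) ^ 2)⁻¹ := by
  rcases ht.eq_or_lt with rfl | ht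
  · simp [regularizer]
  · have h1 : (t : ℂ) ≠ 0 := ofReal_ne_zero.2 ht.ne'
    have h2 : (1 + t : ℂ) ≠ 0 := by
      rw [← ofReal_one, ← ofReal_add]
      exact ofReal_ne_zero.2 (by positivity)
    have h3 : (1 + (t : ℂ)⁻¹) = (1 + t) * (t : ℂ)⁻¹ := by
      field_simp
      ring
    rw [regularizer, h3]
    field_simp

variable {A : H →ₗ.[ℂ] H} {P : H →L[ℂ] H}

/-- The symbol of `e(A)` in the variable `s` is `s / (1 + s)²`, so `(1 + P)² e(A) = P`, and `P` is
injective. -/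
theorem cauchyInt_regularizer_injective (hφ : φ ∈ Ioo 0 Real.pi) (hν : ν ∈ Ioo 0 φ)
    (hP : P.IsPositive) (hinj : Function.Injective P)
    (hA : ∀ x y, (x, y) ∈ A.graph ↔ x = P y) :
    Function.Injective (cauchyInt A ν regularizer) := by
  obtain ⟨C, hC⟩ := exists_isDecaying_regularizer hφ
  have hn : IsStarNormal P := hP.isSelfAdjoint.isStarNormal
  have hne : ∀ s ∈ spectrum ℂ P, (1 + s) ^ 2 ≠ 0 := by
    intro s hs
    obtain ⟨t, ht, rfl⟩ := exists_eq_ofReal_of_mem_spectrum hP hs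
    refine pow_ne_zero _ ?_
    rw [← ofReal_one, ← ofReal_add]
    exact ofReal_ne_zero.2 (by positivity)
  have c1 : ContinuousOn (fun s : ℂ => (1 + s) ^ 2) (spectrum ℂ P) := by fun_prop
  have c2 : ContinuousOn (fun s : ℂ => ((1 + s) ^ 2)⁻¹) (spectrum ℂ P) := c1.inv₀ hne
  have c3 := hC.continuousOn_comp_inv hφ.1 hφ.2.le
    fun s => exists_eq_ofReal_of_mem_spectrum (s := s) hP
  have e : cfc (fun s : ℂ => (1 + s) ^ 2) P * cauchyInt A ν regularizer = P := by
    rw [cauchyInt_eq_cfc hφ.2 hν hC hP hA, ← cfc_mul _ _ P c1 c3]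
    conv_rhs => rw [← cfc_id' ℂ P hn]
    refine cfc_congr fun s hs => ?_
    have := hne s hs
    obtain ⟨t, ht, rfl⟩ := exists_eq_ofReal_of_mem_spectrum hP hs
    rw [regularizer_inv ht, mul_left_comm, mul_inv_cancel₀ this, mul_one]
  intro x y hxy
  apply hinj
  rw [← e, mul_apply_eq_comp, mul_apply_eq_comp, hxy]

theorem isSelfAdjoint_cauchyInt_regularizer (hφ : φ ∈ Ioo 0 Real.pi) (hν : ν ∈ Ioo 0 φ)
    (hP : P.IsPositive) (hA : ∀ x y, (x, y) ∈ A.graph ↔ x = P y) :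
    IsSelfAdjoint (cauchyInt A ν regularizer) := by
  obtain ⟨C, hC⟩ := exists_isDecaying_regularizer hφ
  rw [cauchyInt_eq_cfc hφ.2 hν hC hP hA, IsSelfAdjoint, ← cfc_star]
  refine cfc_congr fun s hs => ?_
  obtain ⟨t, ht, rfl⟩ := exists_eq_ofReal_of_mem_spectrum hP hs
  simp only [regularizer_inv ht]
  simp

/-- The `H^∞`-calculus of a positive self-adjoint operator with bounded inverse is everywhere
defined. -/
theorem exists_cauchyInt_regularizer_apply_eq (hφ : φ ∈ Ioo 0 Real.pi) (hν : ν ∈ Ioo 0 φ)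
    (hP : P.IsPositive) (hinj : Function.Injective P)
    (hA : ∀ x y, (x, y) ∈ A.graph ↔ x = P y) {f : ℂ → ℂ} (hf : IsHInfty φ f) (y : H) :
    ∃ w, cauchyInt A ν regularizer w = cauchyInt A ν (fun z => regularizer z * f z) y := by
  obtain ⟨C, hC⟩ := exists_isDecaying_regularizer hφ
  obtain ⟨C', hC'⟩ := hf.isDecaying_regularizer_mul hφ
  obtain ⟨M, hM⟩ := hf.bounded
  have hn : IsStarNormal P := hP.isSelfAdjoint.isStarNormal
  have hsp := fun s => exists_eq_ofReal_of_mem_spectrum (s := s) hP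
  have c1 := hC.continuousOn_comp_inv hφ.1 hφ.2.le hsp
  have c2 := hC'.continuousOn_comp_inv hφ.1 hφ.2.le hsp
  refine exists_apply_eq_of_norm_le (isSelfAdjoint_cauchyInt_regularizer hφ hν hP hA)
    (cauchyInt_regularizer_injective hφ hν hP hinj hA) ?_ (abs_nonneg M) (fun x => ?_) y
  · rw [cauchyInt_eq_cfc hφ.2 hν hC hP hA, cauchyInt_eq_cfc hφ.2 hν hC' hP hA,
      ← cfc_mul _ _ P c1 c2, ← cfc_mul _ _ P c2 c1]
    exact cfc_congr fun s _ => mul_comm _ _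
  -- Boundedness of `f` enters here: `|ef| ≤ |M| |e|` pointwise on the spectrum.
  · rw [cauchyInt_eq_cfc hφ.2 hν hC hP hA, cauchyInt_eq_cfc hφ.2 hν hC' hP hA]
    refine (abs_le_of_sq_le_sq' ?_ (by positivity)).2
    rw [mul_pow]
    refine norm_cfc_apply_le c2 c1 (fun s hs => ?_) x
    rw [← mul_pow]
    refine pow_le_pow_left₀ (norm_nonneg _) ?_ 2
    obtain ⟨t, ht, rfl⟩ := hsp s hs
    rw [norm_mul, mul_comm]
    rcases ht.eq_or_lt with rfl | ht
    · simp [regularizer]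
    · refine mul_le_mul_of_nonneg_right (le_trans ?_ (le_abs_self M)) (norm_nonneg _)
      rw [← ofReal_inv]
      exact hM _ (ofReal_mem_sector hφ.1 (inv_pos.2 ht))

variable {X K : Type*} [NormedAddCommGroup X] [InnerProductSpace ℂ X] [CompleteSpace X]
  [NormedAddCommGroup K] [InnerProductSpace ℂ K] [CompleteSpace K]
  {V : K →L[ℂ] X} {A : X →ₗ.[ℂ] X} {B : K →ₗ.[ℂ] K}

open ContinuousLinearMap in
theorem isPositive_comp_adjoint (V : K →L[ℂ] X) : (V ∘L adjoint V).IsPositive := by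
  have := isPositive_adjoint_comp_self (adjoint V)
  rwa [adjoint_adjoint] at this

open ContinuousLinearMap in
-- If `x = V^* V (B x)`, then `V x = V V^* (V B x)`, that is, `A V x = V B x`. Hence `(z - A) V x =
-- V (z - B) x`, to be read with `x = (z - B)⁻¹ y`.
theorem resolventOp_comp (hA : ∀ x y, (x, y) ∈ A.graph ↔ x = V (adjoint V y))
    (hB : ∀ x y, (x, y) ∈ B.graph ↔ x = adjoint V (V y)) {z : ℂ} (hz : z.im ≠ 0) :
    resolventOp A z ∘L V = V ∘L resolventOp B z := by
  ext y
  obtain ⟨hd, e⟩ := (isResolventAt_resolventOp (isPositive_adjoint_comp_self V) hB hz).2 y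
  set x := resolventOp B z y with hx
  have hx' := (hB _ _).1 (LinearPMap.mem_graph B ⟨x, hd⟩)
  have hg : (V x, V (B ⟨x, hd⟩)) ∈ A.graph := (hA _ _).2 (congrArg V hx')
  have hd' := LinearPMap.mem_domain_of_mem_graph hg
  have h1 := (isResolventAt_resolventOp (isPositive_comp_adjoint V) hA hz).1 ⟨V x, hd'⟩
  rw [← (LinearPMap.image_iff hd').2 hg, ← map_smul, ← map_sub, e] at h1
  exact h1

open ContinuousLinearMap in
theorem cauchyInt_comp (hφ : φ < Real.pi) (hν : ν ∈ Ioo 0 φ) (hg : IsDecaying φ C g)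
    (hA : ∀ x y, (x, y) ∈ A.graph ↔ x = V (adjoint V y))
    (hB : ∀ x y, (x, y) ∈ B.graph ↔ x = adjoint V (V y)) :
    cauchyInt A ν g ∘L V = V ∘L cauchyInt B ν g := by
  have hab : |ν| < φ := by rw [abs_of_pos hν.1]; exact hν.2
  have hab' : |-ν| < φ := by rwa [abs_neg]
  have hn : -ν ≠ 0 := neg_ne_zero.2 hν.1.ne'
  have key (θ : ℝ) (h0 : θ ≠ 0) (hθ : |θ| < φ) :
      (∫ r in Ioi (0 : ℝ), (g (r * exp (θ * I)) * exp (θ * I)) •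
          resolventOp A (r * exp (θ * I))) ∘L V
        = V ∘L ∫ r in Ioi (0 : ℝ), (g (r * exp (θ * I)) * exp (θ * I)) •
          resolventOp B (r * exp (θ * I)) := by
    have e1 := ((compL ℂ K X X).flip V).integral_comp_comm
      (integrableOn_smul_resolventOp hφ.le hg (isPositive_comp_adjoint V) hA h0 hθ)
    have e2 := (compL ℂ K K X V).integral_comp_comm
      (integrableOn_smul_resolventOp hφ.le hg (isPositive_adjoint_comp_self V) hB h0 hθ)
    refine e1.symm.trans (Eq.trans ?_ e2)
    refine setIntegral_congr_fun measurableSet_Ioi fun r hr => ?_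
    have h := resolventOp_comp hA hB (ray_im_ne_zero h0 (hθ.trans hφ) hr)
    simp only [flip_apply, compL_apply, smul_comp, comp_smul, h]
  rw [cauchyInt_eq_integral_ray, cauchyInt_eq_integral_ray, smul_comp, comp_smul, sub_comp,
    comp_sub, key _ hn hab', key _ hν.1.ne' hab]

open ContinuousLinearMap in
/-- The functional calculi of `(V V^*)⁻¹` and `(V^* V)⁻¹` are intertwined by `V`. -/
theorem exists_mem_graph_funcCalc (hφ : φ ∈ Ioo 0 Real.pi) (hν : ν ∈ Ioo 0 φ)
    {f : ℂ → ℂ} (hf : IsHInfty φ f)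
    (hV : Function.Injective V) (hV' : DenseRange V)
    (hA : ∀ x y, (x, y) ∈ A.graph ↔ x = V (adjoint V y))
    (hB : ∀ x y, (x, y) ∈ B.graph ↔ x = adjoint V (V y)) (y : K) :
    ∃ w, (V y, V w) ∈ (funcCalc A ν f).graph ∧ (y, w) ∈ (funcCalc B ν f).graph := by
  obtain ⟨C, hC⟩ := exists_isDecaying_regularizer hφ
  obtain ⟨C', hC'⟩ := hf.isDecaying_regularizer_mul hφ
  have hVa : Function.Injective (adjoint V) := by
    rw [injective_iff_map_eq_zero]
    intro x hx
    refine hV'.eq_zero_of_inner_left ℂ fun k => ?_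
    rw [← adjoint_inner_left, hx, inner_zero_left]
  have pA := isPositive_comp_adjoint V
  have pB := isPositive_adjoint_comp_self V
  have iA : Function.Injective (V ∘L adjoint V) := hV.comp hVa
  have iB : Function.Injective (adjoint V ∘L V) := hVa.comp hV
  -- The equation is solved only on the side of `B`; transporting it by `V` puts `V y` in the domain
  -- of `f(A)` and at the same time `f(A) V y` in the range of `V`.
  obtain ⟨w, hw⟩ := exists_cauchyInt_regularizer_apply_eq hφ hν pB iB hB hf y
  refine ⟨w, ?_, (mem_graph_funcCalc (cauchyInt_regularizer_injective hφ hν pB iB hB)).2 hw⟩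
  rw [mem_graph_funcCalc (cauchyInt_regularizer_injective hφ hν pA iA hA)]
  have e1 := congrArg (fun L : K →L[ℂ] X => L w) (cauchyInt_comp hφ.2 hν hC hA hB)
  have e2 := congrArg (fun L : K →L[ℂ] X => L y) (cauchyInt_comp hφ.2 hν hC' hA hB)
  simp only [comp_apply] at e1 e2
  rw [e1, e2, hw]

end Abstract

/-! ## The operators `T^* T` and `T T^*` -/

section Factorization

variable {X Y : Type*} [NormedAddCommGroup X] [InnerProductSpace ℂ X] [CompleteSpace X]
  [NormedAddCommGroup Y] [InnerProductSpace ℂ Y]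
  {T : X →ₗ.[ℂ] Y} {S : Submodule ℂ Y} [CompleteSpace S] {V : S →L[ℂ] X}

open ContinuousLinearMap in
-- The graph of `T` consists of the pairs `(V k, k)`, so `T^* y = x` means `⟨k, y⟩ = ⟨V k, x⟩ = ⟨k,
-- V^* x⟩` for all `k ∈ S`, and only the projection of `y` to `S` matters.
theorem mem_graph_adjoint_iff (hd : Dense (T.domain : Set X))
    (hT : ∀ x y, (x, y) ∈ T.graph ↔ ∃ k : S, (k : Y) = y ∧ V k = x) {x : X} {y : Y} :
    (y, x) ∈ T.adjoint.graph ↔ S.orthogonalProjectionOnto y = adjoint V x := by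
  rw [LinearPMap.adjoint_graph_eq_graph_adjoint hd, Submodule.mem_adjoint_iff]
  constructor
  · intro h
    refine ext_inner_left ℂ fun k => ?_
    have h1 := h (V k) k ((hT _ _).2 ⟨k, rfl, rfl⟩)
    rw [adjoint_inner_right, Submodule.coe_inner, ← sub_eq_zero, ← h1]
    congr 1
    rw [← Submodule.coe_inner, Submodule.inner_orthogonalProjectionOnto_eq_of_mem_left]
  · intro h a b hab
    obtain ⟨k, rfl, rfl⟩ := (hT _ _).1 hab
    rw [← Submodule.inner_orthogonalProjectionOnto_eq_of_mem_left, h, adjoint_inner_right, sub_self]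

open ContinuousLinearMap in
theorem mem_graph_adjoint_comp (hd : Dense (T.domain : Set X))
    (hT : ∀ x y, (x, y) ∈ T.graph ↔ ∃ k : S, (k : Y) = y ∧ V k = x) (x z : X) :
    (x, z) ∈ (compMax T.adjoint T).graph ↔ x = V (adjoint V z) := by
  simp only [mem_graph_compMax, mem_graph_adjoint_iff hd hT, hT]
  constructor
  · rintro ⟨_, ⟨k, rfl, rfl⟩, h⟩
    rw [← h, Submodule.orthogonalProjectionOnto_mem_subspace_eq_self]
  · rintro rfl
    exact ⟨_, ⟨adjoint V z, rfl, rfl⟩, Submodule.orthogonalProjectionOnto_mem_subspace_eq_self _⟩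

open ContinuousLinearMap in
theorem mem_graph_comp_adjoint (hd : Dense (T.domain : Set X))
    (hT : ∀ x y, (x, y) ∈ T.graph ↔ ∃ k : S, (k : Y) = y ∧ V k = x) (y z : Y) :
    (y, z) ∈ (compMax T T.adjoint).graph ↔
      ∃ k : S, (k : Y) = z ∧ S.orthogonalProjectionOnto y = adjoint V (V k) := by
  simp only [mem_graph_compMax, mem_graph_adjoint_iff hd hT, hT]
  constructor
  · rintro ⟨_, h, ⟨k, rfl, rfl⟩⟩
    exact ⟨k, rfl, h⟩
  · rintro ⟨k, rfl, h⟩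
    exact ⟨V k, h, k, rfl, rfl⟩

open ContinuousLinearMap in
-- Every `z ∈ S` is attained, at `V^* V z`.
theorem range_comp_adjoint (hd : Dense (T.domain : Set X))
    (hT : ∀ x y, (x, y) ∈ T.graph ↔ ∃ k : S, (k : Y) = y ∧ V k = x) :
    LinearMap.range (compMax T T.adjoint).toFun = S := by
  rw [← LinearPMap.graph_map_snd_eq_range]
  ext z
  simp only [Submodule.mem_map, Prod.exists, mem_graph_comp_adjoint hd hT, LinearMap.snd_apply,
    exists_eq_right]
  constructor
  · rintro ⟨y, k, rfl, -⟩
    exact k.2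
  · intro hz
    exact ⟨adjoint V (V ⟨z, hz⟩), ⟨z, hz⟩, rfl,
      Submodule.orthogonalProjectionOnto_mem_subspace_eq_self _⟩

open ContinuousLinearMap in
theorem mem_graph_partIn_comp_adjoint (hd : Dense (T.domain : Set X))
    (hT : ∀ x y, (x, y) ∈ T.graph ↔ ∃ k : S, (k : Y) = y ∧ V k = x) (y z : S) :
    (y, z) ∈ (partIn (compMax T T.adjoint) S).graph ↔ y = adjoint V (V z) := by
  rw [mem_graph_partIn, mem_graph_comp_adjoint hd hT,
    Submodule.orthogonalProjectionOnto_mem_subspace_eq_self]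
  constructor
  · rintro ⟨k, hk, h⟩
    rwa [Subtype.ext hk] at h
  · exact fun h => ⟨z, rfl, h⟩

/-- The intertwining relation `T f(T^* T) ⊇ f(T T^*) T` for a densely defined operator `T` that is
the inverse of a bounded operator `V` on its range `S`. -/
theorem exists_intertwining (hd : Dense (T.domain : Set X))
    (hT : ∀ x y, (x, y) ∈ T.graph ↔ ∃ k : S, (k : Y) = y ∧ V k = x) {φ ν : ℝ}
    (hφ : φ ∈ Ioo 0 Real.pi) (hν : ν ∈ Ioo 0 φ) {f : ℂ → ℂ} (hf : IsHInfty φ f) (y : S) :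
    ∃ w : S, (V y, V w) ∈ (funcCalc (compMax T.adjoint T) ν f).graph ∧
      (y, w) ∈ (funcCalc (partIn (compMax T T.adjoint) S) ν f).graph := by
  -- `V` is injective because `T` is single-valued, and its range is the dense domain of `T`.
  refine exists_mem_graph_funcCalc hφ hν hf ?_ ?_ (mem_graph_adjoint_comp hd hT)
    (mem_graph_partIn_comp_adjoint hd hT) y
  · rw [injective_iff_map_eq_zero]
    intro k hk
    exact Subtype.ext (T.graph_fst_eq_zero_snd ((hT _ _).2 ⟨k, rfl, rfl⟩) hk)
  · refine hd.mono fun x hx => ?_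
    obtain ⟨k, -, hk⟩ := (hT _ _).1 (LinearPMap.mem_graph T ⟨x, hx⟩)
    exact ⟨k, hk⟩

end Factorization

/-! ## Closedness of the range and density of the domain of `T_D` -/

section Sobolev

variable {n m : ℕ} {O : TopologicalSpace.Opens (E n)}

/-- A continuous function with compact support, as an element of `L²(O)`. -/
noncomputable def testLp (O : TopologicalSpace.Opens (E n)) {θ : E n → ℝ} (hc : Continuous θ)
    (hs : HasCompactSupport θ) : L2 O :=
  MemLp.toLp (fun x => (θ x : ℂ))
    ((continuous_ofReal.comp hc).memLp_of_hasCompactSupport (hs.comp_left ofReal_zero))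

theorem coeFn_testLp {θ : E n → ℝ} (hc : Continuous θ) (hs : HasCompactSupport θ) :
    testLp O hc hs =ᵐ[(volume : Measure (E n)).restrict (O : Set (E n))] fun x => (θ x : ℂ) :=
  MemLp.coeFn_toLp _

/-- Rewriting the weak-derivative identities as inner products with fixed vectors makes them closed
conditions on `(u, g)`. -/
theorem inner_testLp {θ : E n → ℝ} (hc : Continuous θ) (hs : HasCompactSupport θ) (u : L2 O) :
    inner ℂ (testLp O hc hs) u = ∫ x in (O : Set (E n)), θ x • u x := by
  rw [L2.inner_def]
  refine integral_congr_ae ?_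
  filter_upwards [coeFn_testLp hc hs] with x hx
  rw [hx, RCLike.inner_apply, conj_ofReal, real_smul, mul_comm]

theorem isClosed_W12 (O : TopologicalSpace.Opens (E n)) :
    IsClosed (W12 O : Set (WithLp 2 (L2 O × L2Pow O (Fin n)))) := by
  have h : (W12 O : Set (WithLp 2 (L2 O × L2Pow O (Fin n)))) =
      {p | ∀ j, HasWeakDeriv O j p.fst (p.snd j)} := rfl
  rw [h]
  simp only [HasWeakDeriv, ofPred_forall]
  refine isClosed_iInter fun j => isClosed_iInter fun ψ => isClosed_iInter fun hψ =>
    isClosed_iInter fun hs => isClosed_iInter fun _ => ?_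
  have hc' : Continuous fun x => fderiv ℝ ψ x (EuclideanSpace.single j 1) :=
    (hψ.continuous_fderiv (by simp)).clm_apply continuous_const
  have hs' : HasCompactSupport fun x => fderiv ℝ ψ x (EuclideanSpace.single j 1) :=
    hs.fderiv_apply ℝ _
  simp only [← inner_testLp hc' hs', ← inner_testLp hψ.continuous hs]
  exact isClosed_eq (by fun_prop) (by fun_prop)

theorem isClosed_map_W12D (O : TopologicalSpace.Opens (E n)) (D : Set (E n)) :
    IsClosed ((W12D O D).map (W12 O).subtype : Set (WithLp 2 (L2 O × L2Pow O (Fin n)))) := by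
  rw [Submodule.map_coe]
  exact (isClosed_W12 O).isClosedEmbedding_subtypeVal.isClosedMap _
    (Submodule.isClosed_topologicalClosure _)

variable {D : Fin m → Set (E n)}

/-- After regrouping components by `i`, the range is a product of copies of the closed spaces
`W^{1,2}_{D_i}(O)`. Uniqueness of weak derivatives identifies the gradient of the chosen
representative with the given one. -/
theorem mem_range_opT {F : VField O m} :
    F ∈ LinearMap.range (opT O D).toFun ↔ ∀ i, (WithLp.toLp 2 (F.fst i,
      WithLp.toLp 2 fun j => F.snd (i, j)) : WithLp 2 (L2 O × L2Pow O (Fin n))) ∈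
        (W12D O (D i)).map (W12 O).subtype := by
  constructor
  · rintro ⟨u, rfl⟩ i
    refine ⟨(u.2 i).choose, (u.2 i).choose_spec.1, ?_⟩
    have h := (u.2 i).choose_spec.2
    refine (WithLp.ext_iff ..).2 (Prod.ext h ?_)
    rfl
  · intro h
    choose w hw hF using h
    have h1 (i) : (w i).1.fst = F.fst i := by
      have := congrArg WithLp.fst (hF i)
      exact this
    have hu : F.fst ∈ W12Sys O D := fun i => ⟨w i, hw i, h1 i⟩
    refine ⟨⟨F.fst, hu⟩, ?_⟩
    refine (WithLp.ext_iff ..).2 (Prod.ext rfl ?_)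
    ext1 ⟨i, j⟩
    have h2 := W12.snd_eq (hu i).choose (w i) ((hu i).choose_spec.2.trans (h1 i).symm)
    have h3 := congrArg WithLp.snd (hF i)
    have h4 := congrArg (fun a : L2Pow O (Fin n) => a j) (h2.trans h3)
    exact h4

theorem isClosed_range_opT :
    IsClosed (LinearMap.range (opT O D).toFun : Set (VField O m)) := by
  have h : (LinearMap.range (opT O D).toFun : Set (VField O m)) =
      ⋂ i, (fun F : VField O m => (WithLp.toLp 2 (F.fst i,
        WithLp.toLp 2 fun j => F.snd (i, j)) : WithLp 2 (L2 O × L2Pow O (Fin n)))) ⁻¹'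
        ((W12D O (D i)).map (W12 O).subtype : Set (WithLp 2 (L2 O × L2Pow O (Fin n)))) := by
    ext F
    simp only [SetLike.mem_coe, mem_range_opT, mem_iInter, mem_preimage]
  rw [h]
  exact isClosed_iInter fun i => (isClosed_map_W12D O (D i)).preimage (by fun_prop)

/-- A compact subset of the open set `O` has a thickening inside `O`, which cannot meet the
boundary. -/
theorem exists_dist_of_tsupport_subset {ψ : E n → ℝ} (hs : HasCompactSupport ψ)
    (ht : tsupport ψ ⊆ (O : Set (E n))) {D : Set (E n)} (hD : D ⊆ frontier (O : Set (E n))) :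
    ∃ δ : ℝ, 0 < δ ∧ ∀ x ∈ tsupport ψ, ∀ y ∈ D, δ ≤ dist x y := by
  obtain ⟨δ, hδ, h⟩ := hs.isCompact.exists_thickening_subset_open O.isOpen ht
  refine ⟨δ, hδ, fun x hx y hy => ?_⟩
  by_contra! hlt
  have h1 : y ∈ (O : Set (E n)) := h (Metric.mem_thickening_iff.2 ⟨x, hx, by rwa [dist_comm]⟩)
  have h2 := (hD hy).2
  rw [O.isOpen.interior_eq] at h2
  exact h2 h1

theorem exists_mem_W12D {ψ : E n → ℝ} (hψ : ContDiff ℝ ∞ ψ) (hs : HasCompactSupport ψ)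
    (ht : tsupport ψ ⊆ (O : Set (E n))) {D : Set (E n)} (hD : D ⊆ frontier (O : Set (E n))) :
    ∃ w ∈ W12D O D, w.1.fst = testLp O hψ.continuous hs := by
  have hc' (j : Fin n) : Continuous fun x => fderiv ℝ ψ x (EuclideanSpace.single j 1) :=
    (hψ.continuous_fderiv (by simp)).clm_apply continuous_const
  have hs' (j : Fin n) : HasCompactSupport fun x => fderiv ℝ ψ x (EuclideanSpace.single j 1) :=
    hs.fderiv_apply ℝ _
  have hmem : (WithLp.toLp 2 (testLp O hψ.continuous hs,
      WithLp.toLp 2 fun j => testLp O (hc' j) (hs' j)) :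
        WithLp 2 (L2 O × L2Pow O (Fin n))) ∈ W12 O := by
    intro j η hη hηs hηt
    change ∫ x in (O : Set (E n)), (fderiv ℝ η x (EuclideanSpace.single j 1)) •
      testLp O hψ.continuous hs x = - ∫ x in (O : Set (E n)), η x • testLp O (hc' j) (hs' j) x
    have hcη : Continuous fun x => fderiv ℝ η x (EuclideanSpace.single j 1) :=
      (hη.continuous_fderiv (by simp)).clm_apply continuous_const
    have hsη : HasCompactSupport fun x => fderiv ℝ η x (EuclideanSpace.single j 1) :=
      hηs.fderiv_apply ℝ _
    -- The integrands vanish outside `O`, so integration by parts can be done on all of `ℝⁿ`,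
    -- without boundary terms.
    have hO (k : E n → ℝ) (hk : ∀ x ∉ (O : Set (E n)), k x = 0) :
        ∫ x in (O : Set (E n)), (k x : ℂ) = ((∫ x, k x : ℝ) : ℂ) := by
      rw [setIntegral_eq_integral_of_forall_compl_eq_zero
        (fun x hx => by rw [hk x hx, ofReal_zero])]
      exact integral_complex_ofReal
    have e1 : ∫ x in (O : Set (E n)), (fderiv ℝ η x (EuclideanSpace.single j 1)) •
        testLp O hψ.continuous hs x
          = ((∫ x, fderiv ℝ η x (EuclideanSpace.single j 1) * ψ x : ℝ) : ℂ) := by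
      rw [← hO _ fun x hx => by
        rw [image_eq_zero_of_notMem_tsupport fun h => hx (ht h), mul_zero]]
      refine integral_congr_ae ?_
      filter_upwards [coeFn_testLp (O := O) hψ.continuous hs] with x hx
      rw [hx, real_smul, ofReal_mul]
    have e2 : ∫ x in (O : Set (E n)), η x • testLp O (hc' j) (hs' j) x
          = ((∫ x, η x * fderiv ℝ ψ x (EuclideanSpace.single j 1) : ℝ) : ℂ) := by
      rw [← hO _ fun x hx => by
        rw [image_eq_zero_of_notMem_tsupport fun h => hx (hηt h), zero_mul]]
      refine integral_congr_ae ?_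
      filter_upwards [coeFn_testLp (O := O) (hc' j) (hs' j)] with x hx
      rw [hx, real_smul, ofReal_mul]
    rw [e1, e2, integral_mul_fderiv_eq_neg_fderiv_mul_of_integrable, ofReal_neg, neg_neg]
    · exact (hcη.mul hψ.continuous).integrable_of_hasCompactSupport hsη.mul_right
    · exact (hη.continuous.mul (hc' j)).integrable_of_hasCompactSupport hηs.mul_right
    · exact (hη.continuous.mul hψ.continuous).integrable_of_hasCompactSupport hηs.mul_right
    · exact fun x _ => hη.differentiable (by simp) x
    · exact fun x _ => hψ.differentiable (by simp) x
  refine ⟨⟨_, hmem⟩, Submodule.le_topologicalClosure _ ?_, rfl⟩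
  obtain ⟨δ, hδ, hdist⟩ := exists_dist_of_tsupport_subset hs ht hD
  refine ⟨fun x => (ψ x : ℂ), ofRealCLM.contDiff.comp hψ, hs.comp_left ofReal_zero,
    ⟨δ, hδ, fun x hx => hdist x (closure_mono ?_ hx)⟩, coeFn_testLp hψ.continuous hs⟩
  intro y hy
  simpa using hy

/-- A vector orthogonal to the domain is tested with `ψ ∈ C_c^∞(O)` in a single component; the
fundamental lemma of the calculus of variations makes that component vanish. -/
theorem dense_domain_opT (hDO : ∀ i, D i ⊆ frontier (O : Set (E n))) :
    Dense ((opT O D).domain : Set (L2Pow O (Fin m))) := by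
  rw [Submodule.dense_iff_topologicalClosure_eq_top, Submodule.topologicalClosure_eq_top_iff,
    Submodule.eq_bot_iff]
  intro u hu
  ext1 i
  have hae := O.isOpen.ae_eq_zero_of_integral_contDiff_smul_eq_zero
    (locallyIntegrableOn_of_locallyIntegrable_restrict
      ((Lp.memLp (u i)).locallyIntegrable (by norm_num))) (fun ψ hψ hs ht => by
    have hv : (WithLp.toLp 2 (Pi.single i (testLp O hψ.continuous hs)) : L2Pow O (Fin m)) ∈
        W12Sys O D := by
      intro k
      by_cases hk : k = i
      · subst hk
        simpa using exists_mem_W12D hψ hs ht (hDO k)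
      · exact ⟨0, zero_mem _, by simp [hk]⟩
    have h0 := (Submodule.mem_orthogonal _ _).1 hu _ hv
    rw [PiLp.inner_apply, Finset.sum_eq_single i (fun k _ hk => by simp [hk]) (by simp)] at h0
    simp only [Pi.single_eq_same] at h0
    rw [inner_testLp] at h0
    rw [← h0, setIntegral_eq_integral_of_forall_compl_eq_zero]
    intro x hx
    rw [image_eq_zero_of_notMem_tsupport (fun hx' => hx (ht hx')), zero_smul])
  rw [PiLp.zero_apply, Lp.eq_zero_iff_ae_eq_zero]
  exact (ae_restrict_iff' O.isOpen.measurableSet).2 hae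

theorem mem_graph_opT {S : Submodule ℂ (VField O m)}
    (hS : S = LinearMap.range (opT O D).toFun) (x : L2Pow O (Fin m)) (y : VField O m) :
    (x, y) ∈ (opT O D).graph ↔ ∃ k : S, (k : VField O m) = y ∧
      ((WithLp.fstL 2 ℂ _ _).comp S.subtypeL) k = x := by
  subst hS
  rw [LinearPMap.mem_graph_iff]
  constructor
  · rintro ⟨u, rfl, rfl⟩
    exact ⟨⟨_, u, rfl⟩, rfl, rfl⟩
  · rintro ⟨⟨_, u, rfl⟩, rfl, rfl⟩
    exact ⟨u, rfl, rfl⟩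

theorem ranM_eq (hDO : ∀ i, D i ⊆ frontier (O : Set (E n))) :
    ranM O D = LinearMap.range (opT O D).toFun := by
  have hcl := isClosed_range_opT (O := O) (D := D)
  have : CompleteSpace (LinearMap.range (opT O D).toFun) := hcl.completeSpace_coe
  rw [ranM, opM, range_comp_adjoint (dense_domain_opT hDO) (mem_graph_opT rfl)]
  exact hcl.submodule_topologicalClosure_eq

end Sobolev

end MixedBC

/-! ### The intertwining relation for `T_D` -/

theorem proposition3p6 {n m : ℕ} (O : TopologicalSpace.Opens (MixedBC.E n))
    (D : Fin m → Set (MixedBC.E n)) (hD : ∀ i, IsClosed (D i))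
    (hDO : ∀ i, D i ⊆ frontier (O : Set (MixedBC.E n)))
    {φ : ℝ} (hφ : φ ∈ Set.Ioo 0 Real.pi) {f : ℂ → ℂ} (hf : MixedBC.IsHInfty φ f)
    {ν : ℝ} (hν : ν ∈ Set.Ioo 0 φ)
    (u : MixedBC.L2Pow O (Fin m)) (hu : u ∈ MixedBC.W12Sys O D) :
    ∃ (h₁ : u ∈ (MixedBC.funcCalc (MixedBC.opLap O D) ν f).domain)
      (h₂ : MixedBC.funcCalc (MixedBC.opLap O D) ν f ⟨u, h₁⟩ ∈ (MixedBC.opT O D).domain)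
      (h₃ : MixedBC.opT O D ⟨u, hu⟩ ∈ MixedBC.ranM O D)
      (h₄ : (⟨MixedBC.opT O D ⟨u, hu⟩, h₃⟩ : MixedBC.ranM O D) ∈
        (MixedBC.funcCalc (MixedBC.opMInj O D) ν f).domain),
      MixedBC.opT O D ⟨MixedBC.funcCalc (MixedBC.opLap O D) ν f ⟨u, h₁⟩, h₂⟩ =
        (MixedBC.funcCalc (MixedBC.opMInj O D) ν f ⟨⟨MixedBC.opT O D ⟨u, hu⟩, h₃⟩, h₄⟩ :
          MixedBC.VField O m) := by
  have hran := MixedBC.ranM_eq hDO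
  have hcl : IsClosed (MixedBC.ranM O D : Set (MixedBC.VField O m)) :=
    Submodule.isClosed_topologicalClosure _
  have : CompleteSpace (MixedBC.ranM O D) := hcl.completeSpace_coe
  have hT := MixedBC.mem_graph_opT hran
  have h₃ : MixedBC.opT O D ⟨u, hu⟩ ∈ MixedBC.ranM O D := by
    rw [hran]
    exact ⟨⟨u, hu⟩, rfl⟩
  -- Taken at `y = T_D u`, whose first component `V y` is `u` by definition.
  obtain ⟨w, hA, hB⟩ := MixedBC.exists_intertwining (MixedBC.dense_domain_opT hDO) hT hφ hν hf
    ⟨_, h₃⟩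
  have h₁ := LinearPMap.mem_domain_of_mem_graph hA
  have h₄ := LinearPMap.mem_domain_of_mem_graph hB
  have e₁ := (LinearPMap.image_iff h₁).2 hA
  have e₂ := (LinearPMap.image_iff h₄).2 hB
  have hw := (hT _ _).2 ⟨w, rfl, rfl⟩
  have hwd := LinearPMap.mem_domain_of_mem_graph hw
  have e₃ := (LinearPMap.image_iff hwd).2 hw
  refine ⟨h₁, ?_, h₃, h₄, ?_⟩
  · exact e₁ ▸ hwd
  · refine Eq.trans ?_ (e₃.symm.trans (congrArg Subtype.val e₂))
    congr 1
    exact Subtype.ext e₁.symm
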